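/- For $p\ge 1$ and $M>0$ let $\mathcal F(M)$ be the set of symmetric positive semi-definite matrices $\Sigma\in\mathbb R^{p\times p}$ with operator norm (largest singular value) $\|\Sigma\|_{\rm op}\le M$. For an integer $k\ge 0$ and for $\alpha,M_0>0$ put $$\mathcal F_k(M)=\{\Sigma=(\sigma_{ij})\in\mathcal F(M):\ \sigma_{ij}=0\text{ if }|i-j|>k\},$$ $$\mathcal F_\alpha(M,M_0)=\Big\{\Sigma=(\sigma_{ij})\in\mathcal F(M):\ \max_j\sum_{i:|i-j|>m}|\sigma_{ij}|\le M_0\,m^{-\alpha}\ \text{ for every integer } m\ge1\Big\}.$$ For $\epsilon\in[0,1]$ and a probability distribution $Q$ on $\mathbb R^p$, let $\mathbb P_{(\epsilon,\Sigma,Q)}$ denote the law of $n$ i.i.d. observations $X_1,\dots,X_n$ from $(1-\epsilon)N(0,\Sigma)+\epsilon Q$. Below, $\inf_{\hat\Sigma}$ is over all estimators, i.e. measurable functions $\hat\Sigma$ of $X_1,\dots,X_n$ with values in $\mathbb R^{p\times p}$, and $\sup_Q$ is over all probability distributions on $\mathbb R^p$; $a\vee b=\max(a,b)$. (i) For all $M,\gamma,\kappa>0$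 there are constants $C,c>0$, depending only on $M,\gamma,\kappa$, such that for all integers $n,p\ge 1$ and $k\ge 0$ with $p\le\exp(\gamma n)$, $k\le p$ and $k\le\kappa n$, and for every $\epsilon\in[0,1]$, $$\inf_{\hat\Sigma}\ \sup_{\Sigma\in\mathcal F_k(M)}\ \sup_Q\ \mathbb P_{(\epsilon,\Sigma,Q)}\Big\{\|\hat\Sigma-\Sigma\|_{\rm op}^2\ge C\Big(\frac{k+\log p}{n}\vee\epsilon^2\Big)\Big\}\ge c .$$ (ii) For all $\alpha,M,M_0,\gamma>0$ there are constants $C,c>0$, depending only on $\alpha,M,M_0,\gamma$, such that for all integers $n,p\ge 1$ with $p\le\exp(\gamma n)$ and for every $\epsilon\in[0,1]$, $$\inf_{\hat\Sigma}\ \sup_{\Sigma\in\mathcal F_\alpha(M,M_0)}\ \sup_Q\ \mathbb P_{(\epsilon,\Sigma,Q)}\Big\{\|\hat\Sigma-\Sigma\|_{\rm op}^2\ge C\Big(\min\Big\{n^{-\frac{2\alpha}{2\alpha+1}}+\frac{\log p}{n},\ \frac pn\Big\}\vee\epsilon^2\Big)\Big\}\ge c .$$ -/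

import Mathlib

open MeasureTheory ProbabilityTheory
open scoped ENNReal Matrix

noncomputable section

namespace RobustCov

/-- The operator norm (largest singular value) of a square matrix, i.e. its norm as a map of
Euclidean space. -/
def opNorm {p : ℕ} (A : Matrix (Fin p) (Fin p) ℝ) : ℝ :=
  ‖Matrix.toEuclideanCLM (n := Fin p) (𝕜 := ℝ) A‖

/-- Positive semi-definite matrices with largest singular value at most `M`. -/
def boundedClass (p : ℕ) (M : ℝ) : Set (Matrix (Fin p) (Fin p) ℝ) :=
  {S | S.PosSemidef ∧ opNorm S ≤ M}

/-- Matrices in `boundedClass p M` with bandwidth `k`: `S i j = 0` whenever `|i - j| > k`. -/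
def bandedClass (p k : ℕ) (M : ℝ) : Set (Matrix (Fin p) (Fin p) ℝ) :=
  {S | S ∈ boundedClass p M ∧
    ∀ i j : Fin p, (k : ℤ) < |((i : ℕ) : ℤ) - ((j : ℕ) : ℤ)| → S i j = 0}

/-- Bandable matrices in `boundedClass p M`: for every `k ≥ 1` and every column `j`, the sum of
`|S i j|` over `|i - j| > k` is at most `M₀ k ^ (-α)`. -/
def bandableClass (p : ℕ) (α M M₀ : ℝ) : Set (Matrix (Fin p) (Fin p) ℝ) :=
  {S | S ∈ boundedClass p M ∧ ∀ k : ℕ, 1 ≤ k → ∀ j : Fin p,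
    ∑ i ∈ Finset.univ.filter (fun i : Fin p =>
      (k : ℤ) < |((i : ℕ) : ℤ) - ((j : ℕ) : ℤ)|), |S i j|
      ≤ M₀ * (k : ℝ) ^ (-α)}

/-- The contaminated distribution `(1 - ε) N(0, S) + ε Q` on `ℝ^p`. -/
def contaminated {p : ℕ} (ε : ℝ) (S : Matrix (Fin p) (Fin p) ℝ)
    (Q : Measure (EuclideanSpace ℝ (Fin p))) : Measure (EuclideanSpace ℝ (Fin p)) :=
  ENNReal.ofReal (1 - ε) • multivariateGaussian 0 S + ENNReal.ofReal ε • Q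

/-- The joint law of `n` i.i.d. observations from the contaminated distribution. -/
def sampleLaw {p : ℕ} (n : ℕ) (ε : ℝ) (S : Matrix (Fin p) (Fin p) ℝ)
    (Q : Measure (EuclideanSpace ℝ (Fin p))) : Measure (Fin n → EuclideanSpace ℝ (Fin p)) :=
  Measure.pi fun _ => contaminated ε S Q

/-- Estimators of a `p × p` matrix from `n` observations: maps all of whose entries are
measurable functions of the data. -/
def IsEstimator {n p : ℕ}
    (T : (Fin n → EuclideanSpace ℝ (Fin p)) → Matrix (Fin p) (Fin p) ℝ) : Prop :=
  ∀ i j : Fin p, Measurable fun x => T x i j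

/-- The minimax probability
`inf_T sup_{S ∈ Θ} sup_Q P_{(ε, S, Q)} {‖T - S‖² ≥ r}` for `n` observations in `ℝ^p`, where `T`
ranges over all estimators and `Q` over all probability measures on `ℝ^p`. -/
def minimaxProb {p : ℕ} (n : ℕ) (Θ : Set (Matrix (Fin p) (Fin p) ℝ)) (ε r : ℝ) : ℝ≥0∞ :=
  ⨅ (T : (Fin n → EuclideanSpace ℝ (Fin p)) → Matrix (Fin p) (Fin p) ℝ) (_ : IsEstimator T),
    ⨆ (S : Matrix (Fin p) (Fin p) ℝ) (_ : S ∈ Θ)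
      (Q : ProbabilityMeasure (EuclideanSpace ℝ (Fin p))),
      sampleLaw n ε S (Q : Measure (EuclideanSpace ℝ (Fin p))) {x | r ≤ opNorm (T x - S) ^ 2}

end RobustCov

end

/-! Up to a constant, each rate is the larger of a contamination term, a logarithmic term and a
dimension term. Lowering the threshold only raises the minimax probability, so each term may be
bounded separately and the dominant one used.

Contamination: `(1 - ε) N(0, a)` is dominated, as a measure, by `N(0, a (1 + ε)²)`. Hence a suitable
`Q` makes the contaminated model at `a u uᵀ` coincide with the clean model at `a (1 + ε)² u uᵀ`.
These matrices are at distance at least `2 a ε`, and no sample size separates them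
(`le_minimaxProb_of_contamination`).

The other terms need no contamination, since `Q = N(0, S)` makes it invisible. Take `a I` against
the spikes `a (I + δ u uᵀ)`, with `u` uniform on a finite set of unit vectors. For independent draws
`u`, `u'` from this prior, the second moment of the mixture likelihood ratio is at most `E exp(n δ²
⟪u, u'⟫²)`. If this is at most 2, no estimator is accurate under the null and under all spikes
(`le_minimaxProb_of_spikes`). Coordinate vectors allow `δ² ≍ log p / n`; random signs on `m`
coordinates allow `δ² ≍ m / n`.

For banded matrices `m = k`. For bandable ones the spike must also satisfy `δ ≲ m ^ (-α)`, and
balancing this with `δ² ≍ m / n` gives `m ≍ n ^ (1 / (2 α + 1))`, capped at `p`. -/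

namespace RobustCov

open scoped RealInnerProductSpace

/-! ### Densities of product measures -/

section ProductMeasures

variable {ι : Type*} [Fintype ι] {X : ι → Type*} [∀ i, MeasurableSpace (X i)]

lemma lintegral_pi_prod (μ : ∀ i, Measure (X i)) [∀ i, IsProbabilityMeasure (μ i)]
    {f : ∀ i, X i → ℝ≥0∞} (hf : ∀ i, Measurable (f i)) :
    ∫⁻ x, ∏ i, f i (x i) ∂Measure.pi μ = ∏ i, ∫⁻ x, f i x ∂μ i := by
  have hind : iIndepFun (fun i (x : ∀ i, X i) => f i (x i)) (Measure.pi μ) :=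
    iIndepFun_pi (X := f) fun i => (hf i).aemeasurable
  rw [lintegral_prod_eq_prod_lintegral_of_indepFun Finset.univ _ hind
    (fun i => (hf i).comp (measurable_pi_apply i))]
  refine Finset.prod_congr rfl fun i _ => ?_
  exact (measurePreserving_eval μ i).lintegral_comp (hf i)

lemma pi_withDensity (μ : ∀ i, Measure (X i)) [∀ i, IsProbabilityMeasure (μ i)]
    {f : ∀ i, X i → ℝ≥0∞} (hf : ∀ i, Measurable (f i))
    [∀ i, IsProbabilityMeasure ((μ i).withDensity (f i))] :
    Measure.pi (fun i => (μ i).withDensity (f i)) =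
      (Measure.pi μ).withDensity fun x => ∏ i, f i (x i) := by
  refine Measure.pi_eq (μ := fun i => (μ i).withDensity (f i)) (fun s hs => ?_)
  have hS : MeasurableSet (Set.univ.pi s) := MeasurableSet.univ_pi hs
  have key : ∀ x : ∀ i, X i, (Set.univ.pi s).indicator (fun x => ∏ i, f i (x i)) x =
      ∏ i, (s i).indicator (f i) (x i) := by
    intro x
    by_cases hx : x ∈ Set.univ.pi s
    · rw [Set.indicator_of_mem hx]
      exact Finset.prod_congr rfl fun i _ => (Set.indicator_of_mem (hx i trivial) _).symm
    · rw [Set.indicator_of_notMem hx]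
      simp only [Set.mem_univ_pi, not_forall] at hx
      obtain ⟨i, hi⟩ := hx
      exact (Finset.prod_eq_zero (Finset.mem_univ i) (Set.indicator_of_notMem hi _)).symm
  rw [withDensity_apply _ hS, ← lintegral_indicator hS]
  simp_rw [key]
  rw [lintegral_pi_prod μ fun i => (hf i).indicator (hs i)]
  refine Finset.prod_congr rfl fun i _ => ?_
  rw [lintegral_indicator (hs i), withDensity_apply _ (hs i)]

end ProductMeasures

/-- Le Cam's method for a simple hypothesis against a finite mixture, with the second moment of
the likelihood ratio of the mixture controlled by `2`. -/
lemma exists_le_of_second_moment {X ι : Type*} [MeasurableSpace X] [Fintype ι] [Nonempty ι]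
    (μ : Measure X) [IsProbabilityMeasure μ] {f : ι → X → ℝ≥0∞} (hf : ∀ j, Measurable (f j))
    (hprob : ∀ j, IsProbabilityMeasure (μ.withDensity (f j)))
    (hsecond : ∑ j, ∑ l, ∫⁻ x, f j x * f l x ∂μ ≤ 2 * (Fintype.card ι : ℝ≥0∞) ^ 2)
    {A : Set X} {B : ι → Set X} (hA : MeasurableSet A)
    (hAB : ∀ j, Aᶜ ⊆ B j) :
    ENNReal.ofReal (1 / 8) ≤ μ A ∨ ∃ j, ENNReal.ofReal (1 / 8) ≤ μ.withDensity (f j) (B j) := by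
  by_contra! hcon
  obtain ⟨hμA, hB⟩ := hcon
  set N : ℝ≥0∞ := (Fintype.card ι : ℝ≥0∞) with hN
  have hN0 : N ≠ 0 := by simp [hN]
  have hNt : N ≠ ∞ := by simp [hN]
  set F : X → ℝ≥0∞ := fun x => ∑ j, f j x with hF
  have hFm : Measurable F := Finset.measurable_sum _ fun j _ => hf j
  have hF1 : ∫⁻ x, F x ∂μ = N := by
    rw [lintegral_finsetSum _ fun j _ => hf j]
    have : ∀ j, ∫⁻ x, f j x ∂μ = 1 := fun j => by
      have := (hprob j).measure_univ
      rwa [withDensity_apply _ MeasurableSet.univ, setLIntegral_univ] at this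
    simp [this, hN]
  have hF2 : ∫⁻ x, F x ^ 2 ∂μ ≤ 2 * N ^ 2 := by
    refine le_trans (le_of_eq ?_) hsecond
    have : ∀ x, F x ^ 2 = ∑ j, ∑ l, f j x * f l x := fun x => by
      rw [sq, Finset.sum_mul_sum]
    simp_rw [this]
    rw [lintegral_finsetSum _ fun j _ => by fun_prop]
    refine Finset.sum_congr rfl fun j _ => ?_
    rw [lintegral_finsetSum _ fun l _ => by fun_prop]
  have hAc : ∫⁻ x in Aᶜ, F x ∂μ ≤ N * ENNReal.ofReal (1 / 8) := by
    rw [lintegral_finsetSum _ fun j _ => hf j]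
    calc ∑ j, ∫⁻ x in Aᶜ, f j x ∂μ ≤ ∑ _j : ι, ENNReal.ofReal (1 / 8) := by
          refine Finset.sum_le_sum fun j _ => ?_
          rw [← withDensity_apply _ hA.compl]
          exact (measure_mono (hAB j)).trans (hB j).le
      _ = N * ENNReal.ofReal (1 / 8) := by simp [hN]
  have hAin : ∫⁻ x in A, F x ∂μ ≤ N * ENNReal.ofReal (1 / 2) := by
    -- This is `(F - 4 N)² ≥ 0`, a weighted substitute for Cauchy–Schwarz. Integrated over `A` with
    -- `μ A < 1/8`, it bounds the mixture mass of `A` by `1/2`; with at most `1/8` on the complement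
    -- the total falls short of 1.
    have hpt : ∀ x, N * F x ≤ ENNReal.ofReal (1 / 8) * F x ^ 2 + 2 * N ^ 2 := by
      intro x
      rcases eq_or_ne (F x) ∞ with h | h
      · simp [h]
      · lift F x to NNReal using h with y
        lift N to NNReal using hNt with m
        rw [ENNReal.ofReal]
        norm_cast
        rw [← NNReal.coe_le_coe]
        push_cast
        rw [Real.coe_toNNReal _ (by norm_num)]
        nlinarith [sq_nonneg ((y : ℝ) - 4 * m)]
    have h1 : N * ∫⁻ x in A, F x ∂μ ≤ N * (N * ENNReal.ofReal (1 / 2)) := by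
      calc N * ∫⁻ x in A, F x ∂μ = ∫⁻ x in A, N * F x ∂μ := (lintegral_const_mul _ hFm).symm
        _ ≤ ∫⁻ x in A, (ENNReal.ofReal (1 / 8) * F x ^ 2 + 2 * N ^ 2) ∂μ :=
          lintegral_mono hpt
        _ = ENNReal.ofReal (1 / 8) * ∫⁻ x in A, F x ^ 2 ∂μ + 2 * N ^ 2 * μ A := by
          rw [lintegral_add_right _ measurable_const,
            lintegral_const_mul _ (hFm.pow_const 2)]
          simp
        _ ≤ ENNReal.ofReal (1 / 8) * (2 * N ^ 2) + 2 * N ^ 2 * ENNReal.ofReal (1 / 8) := by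
          gcongr
          exact (setLIntegral_le_lintegral _ _).trans hF2
        _ = N * (N * (4 * ENNReal.ofReal (1 / 8))) := by ring
        _ = N * (N * ENNReal.ofReal (1 / 2)) := by
          rw [show (4 : ℝ≥0∞) = ENNReal.ofReal 4 by simp, ← ENNReal.ofReal_mul (by norm_num)]
          norm_num
    exact (ENNReal.mul_le_mul_iff_right hN0 hNt).1 h1
  have hlt : N * ENNReal.ofReal (1 / 2) + N * ENNReal.ofReal (1 / 8) < N := by
    rw [← mul_add, ← ENNReal.ofReal_add (by norm_num) (by norm_num)]
    conv_rhs => rw [← mul_one N]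
    refine (ENNReal.mul_lt_mul_iff_right hN0 hNt).2 ?_
    rw [ENNReal.ofReal_lt_one]
    norm_num
  refine absurd hlt (not_lt.2 ?_)
  calc N = ∫⁻ x, F x ∂μ := hF1.symm
    _ = ∫⁻ x in A, F x ∂μ + ∫⁻ x in Aᶜ, F x ∂μ := (lintegral_add_compl _ hA).symm
    _ ≤ _ := add_le_add hAin hAc

/-! ### Gaussian likelihood ratios for shifts and rank one spikes -/

section Gaussian

lemma gaussianReal_one_eq_withDensity (h : ℝ) :
    gaussianReal h 1 = (gaussianReal 0 1).withDensity
      fun x => ENNReal.ofReal (Real.exp (h * x - h ^ 2 / 2)) := by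
  rw [gaussianReal_of_var_ne_zero _ one_ne_zero, gaussianReal_of_var_ne_zero _ one_ne_zero,
    ← withDensity_mul _ (measurable_gaussianPDF _ _) (by fun_prop)]
  congr 1
  ext x
  rw [Pi.mul_apply, gaussianPDF, gaussianPDF, ← ENNReal.ofReal_mul (gaussianPDFReal_nonneg _ _ _),
    gaussianPDFReal, gaussianPDFReal, mul_assoc _ (Real.exp _), ← Real.exp_add]
  congr 3
  simp
  ring

lemma lintegral_exp_mul_gaussianReal (c : ℝ) :
    ∫⁻ g, ENNReal.ofReal (Real.exp (c * g)) ∂gaussianReal 0 1 =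
      ENNReal.ofReal (Real.exp (c ^ 2 / 2)) := by
  have h1 : ((gaussianReal 0 1).withDensity
      fun x => ENNReal.ofReal (Real.exp (c * x - c ^ 2 / 2))) Set.univ = 1 := by
    rw [← gaussianReal_one_eq_withDensity]
    simp
  rw [withDensity_apply _ MeasurableSet.univ, setLIntegral_univ] at h1
  have hpt : ∀ g, ENNReal.ofReal (Real.exp (c * g)) =
      ENNReal.ofReal (Real.exp (c ^ 2 / 2)) *
        ENNReal.ofReal (Real.exp (c * g - c ^ 2 / 2)) := by
    intro g
    rw [← ENNReal.ofReal_mul (Real.exp_pos _).le, ← Real.exp_add]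
    congr 2
    ring
  simp_rw [hpt]
  rw [lintegral_const_mul _ (by fun_prop), h1, mul_one]

/-- Exponential moment of the square of a standard Gaussian variable. -/
lemma lintegral_exp_sq_gaussianReal {s : ℝ} (hs : s < 1) :
    ∫⁻ x, ENNReal.ofReal (Real.exp (s * x ^ 2 / 2)) ∂gaussianReal 0 1 =
      ENNReal.ofReal ((√(1 - s))⁻¹) := by
  have h1s : 0 < 1 - s := sub_pos.2 hs
  have hv : Real.toNNReal ((1 - s)⁻¹) ≠ 0 := by simpa using h1s
  rw [gaussianReal_of_var_ne_zero _ one_ne_zero,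
    lintegral_withDensity_eq_lintegral_mul _ (measurable_gaussianPDF _ _) (by fun_prop)]
  -- The tilted density is a multiple of the density of `N(0, 1 / (1 - s))`.
  have hpt : ∀ x, (gaussianPDF 0 1 * fun x => ENNReal.ofReal (Real.exp (s * x ^ 2 / 2))) x =
      ENNReal.ofReal ((√(1 - s))⁻¹) * gaussianPDF 0 (Real.toNNReal ((1 - s)⁻¹)) x := by
    intro x
    rw [Pi.mul_apply, gaussianPDF, gaussianPDF,
      ← ENNReal.ofReal_mul (gaussianPDFReal_nonneg _ _ _), ← ENNReal.ofReal_mul (by positivity),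
      gaussianPDFReal, gaussianPDFReal, mul_assoc, ← Real.exp_add,
      Real.coe_toNNReal _ (by positivity)]
    congr 1
    rw [← mul_assoc, Real.sqrt_mul (by positivity) ((1 - s)⁻¹), Real.sqrt_inv]
    congr 1
    · have : √(1 - s) ≠ 0 := (Real.sqrt_pos.2 h1s).ne'
      simp only [NNReal.coe_one, mul_one, mul_inv, inv_inv]
      field_simp
    · congr 1
      simp
      field_simp
      ring
  simp_rw [hpt]
  rw [lintegral_const_mul _ (measurable_gaussianPDF _ _), lintegral_gaussianPDF_eq_one _ hv, mul_one]

/-- Squaring reduces this to `(1 + 2 s) (1 - s) ≥ 1`, that is `s (1 - 2 s) ≥ 0`. -/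
lemma inv_sqrt_one_sub_le_exp {s : ℝ} (hs0 : 0 ≤ s) (hs : s ≤ 1 / 2) :
    (√(1 - s))⁻¹ ≤ Real.exp s := by
  have h1 : Real.exp (-s) ≤ √(1 - s) := by
    refine Real.le_sqrt_of_sq_le ?_
    rw [← Real.exp_nat_mul]
    have h2 : Real.exp (-(2 * s)) ≤ 1 - s := by
      rw [Real.exp_neg, inv_le_comm₀ (Real.exp_pos _) (by linarith)]
      refine le_trans ?_ (Real.add_one_le_exp _)
      rw [inv_le_iff_one_le_mul₀ (by linarith)]
      nlinarith
    convert h2 using 2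
    push_cast
    ring
  rw [inv_le_comm₀ (lt_of_lt_of_le (Real.exp_pos _) h1) (Real.exp_pos _), ← Real.exp_neg]
  exact h1

lemma inv_sqrt_one_sub_le_two {s : ℝ} (hs : s ≤ 1 / 2) : (√(1 - s))⁻¹ ≤ 2 := by
  have h1 : (1 / 2 : ℝ) ≤ √(1 - s) := Real.le_sqrt_of_sq_le (by nlinarith)
  rw [inv_le_comm₀ (by linarith) (by norm_num)]
  linarith

variable {ι : Type*} [Fintype ι]

/-- The density of `N(h, I)` with respect to `N(0, I)`. -/
noncomputable def shiftDensity (h x : EuclideanSpace ℝ ι) : ℝ≥0∞ :=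
  ENNReal.ofReal (Real.exp (⟪h, x⟫ - ‖h‖ ^ 2 / 2))

lemma measurable_shiftDensity (h : EuclideanSpace ℝ ι) : Measurable (shiftDensity h) := by
  unfold shiftDensity
  fun_prop

lemma measurable_shiftDensity_smul (v : EuclideanSpace ℝ ι) :
    Measurable fun q : EuclideanSpace ℝ ι × ℝ => shiftDensity (q.2 • v) q.1 := by
  unfold shiftDensity
  fun_prop

/-- The Cameron–Martin formula, which factors over coordinates. -/
lemma stdGaussian_map_add (h : EuclideanSpace ℝ ι) :
    (stdGaussian (EuclideanSpace ℝ ι)).map (fun x => x + h) =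
      (stdGaussian (EuclideanSpace ℝ ι)).withDensity (shiftDensity h) := by
  have hprob : ∀ i, IsProbabilityMeasure ((gaussianReal 0 1).withDensity
      fun x => ENNReal.ofReal (Real.exp (h i * x - h i ^ 2 / 2))) := fun i => by
    rw [← gaussianReal_one_eq_withDensity]
    infer_instance
  have hpi : (Measure.pi fun _ : ι => gaussianReal 0 1).map (fun x i => x i + h i) =
      (Measure.pi fun _ : ι => gaussianReal 0 1).withDensity
        fun x => shiftDensity h (WithLp.toLp 2 x) := by
    rw [Measure.pi_map_pi (f := fun i x => x + h i) (fun i => by fun_prop)]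
    simp_rw [gaussianReal_map_add_const, zero_add, gaussianReal_one_eq_withDensity (h _)]
    rw [pi_withDensity (fun _ => gaussianReal 0 1)
      (f := fun i x => ENNReal.ofReal (Real.exp (h i * x - h i ^ 2 / 2))) (fun i => by fun_prop)]
    congr 1
    ext x
    rw [← ENNReal.ofReal_prod_of_nonneg (fun i _ => (Real.exp_pos _).le), ← Real.exp_sum,
      shiftDensity, EuclideanSpace.real_norm_sq_eq, Finset.sum_sub_distrib, Finset.sum_div]
    simp [PiLp.inner_apply, mul_comm]
  rw [← map_pi_eq_stdGaussian, Measure.map_map (by fun_prop) (by fun_prop)]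
  have hcomp : (fun x : EuclideanSpace ℝ ι => x + h) ∘ WithLp.toLp 2 =
      WithLp.toLp 2 ∘ fun (x : ι → ℝ) i => x i + h i := by
    ext x i
    simp
  rw [hcomp, ← Measure.map_map (by fun_prop) (by fun_prop), hpi]
  ext A hA
  have hm : Measurable (WithLp.toLp 2 : (ι → ℝ) → EuclideanSpace ℝ ι) := by fun_prop
  rw [Measure.map_apply hm hA, withDensity_apply _ (hm hA), withDensity_apply _ hA,
    setLIntegral_map hA (measurable_shiftDensity h) hm]

lemma lintegral_shiftDensity (h : EuclideanSpace ℝ ι) :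
    ∫⁻ x, shiftDensity h x ∂stdGaussian (EuclideanSpace ℝ ι) = 1 := by
  rw [← setLIntegral_univ, ← withDensity_apply _ MeasurableSet.univ, ← stdGaussian_map_add,
    Measure.map_apply (by fun_prop) MeasurableSet.univ]
  simp

lemma lintegral_shiftDensity_mul (h h' : EuclideanSpace ℝ ι) :
    ∫⁻ x, shiftDensity h x * shiftDensity h' x ∂stdGaussian (EuclideanSpace ℝ ι) =
      ENNReal.ofReal (Real.exp ⟪h, h'⟫) := by
  have hpt : ∀ x, shiftDensity h x * shiftDensity h' x =
      ENNReal.ofReal (Real.exp ⟪h, h'⟫) * shiftDensity (h + h') x := by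
    intro x
    rw [shiftDensity, shiftDensity, shiftDensity, ← ENNReal.ofReal_mul (Real.exp_pos _).le,
      ← ENNReal.ofReal_mul (Real.exp_pos _).le, ← Real.exp_add, ← Real.exp_add,
      norm_add_sq_real, inner_add_left]
    congr 2
    ring
  simp_rw [hpt]
  rw [lintegral_const_mul _ (measurable_shiftDensity _), lintegral_shiftDensity, mul_one]

/-- The density of `N(0, I + v vᵀ)` with respect to `N(0, I)`, as a mixture of shifts. -/
noncomputable def spikedDensity (v x : EuclideanSpace ℝ ι) : ℝ≥0∞ :=
  ∫⁻ g, shiftDensity (g • v) x ∂gaussianReal 0 1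

lemma measurable_spikedDensity (v : EuclideanSpace ℝ ι) : Measurable (spikedDensity v) :=
  (measurable_shiftDensity_smul v).lintegral_prod_right'

lemma posSemidef_vecMulVec_self (v : ι → ℝ) : (Matrix.vecMulVec v v).PosSemidef := by
  simpa using Matrix.posSemidef_vecMulVec_self_star v

lemma dotProduct_vecMulVec_self_mulVec (v t : EuclideanSpace ℝ ι) :
    t.ofLp ⬝ᵥ Matrix.vecMulVec v.ofLp v.ofLp *ᵥ t.ofLp = ⟪v, t⟫ ^ 2 := by
  simp only [Matrix.vecMulVec_mulVec, PiLp.inner_apply, dotProduct, sq, Finset.sum_mul_sum]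
  simp only [Pi.smul_apply, MulOpposite.smul_eq_mul_unop, MulOpposite.unop_op, Finset.mul_sum]
  exact Finset.sum_congr rfl fun _ _ => Finset.sum_congr rfl fun _ _ => by simp; ring

/-- If `Z` is standard Gaussian and `g` an independent standard normal, `Z + g v` has covariance `I
+ v vᵀ`. Conditioning on `g` presents the density as a mixture of shifts, with no determinant or
inverse matrix; characteristic functions identify the convolution. -/
lemma withDensity_spikedDensity [DecidableEq ι] (v : EuclideanSpace ℝ ι) :
    (stdGaussian (EuclideanSpace ℝ ι)).withDensity (spikedDensity v) =
      multivariateGaussian 0 (1 + Matrix.vecMulVec v v) := by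
  have hconv : (stdGaussian (EuclideanSpace ℝ ι)).withDensity (spikedDensity v) =
      stdGaussian (EuclideanSpace ℝ ι) ∗ (gaussianReal 0 1).map (fun g => g • v) := by
    ext A hA
    rw [withDensity_apply _ hA, Measure.conv, Measure.map_apply (by fun_prop) hA,
      Measure.prod_apply_symm ((measurable_add : Measurable fun q : _ × _ => q.1 + q.2) hA),
      lintegral_map (measurable_measure_prodMk_right
        ((measurable_add : Measurable fun q : _ × _ => q.1 + q.2) hA)) (by fun_prop)]
    unfold spikedDensity
    rw [lintegral_lintegral_swap (measurable_shiftDensity_smul v).aemeasurable]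
    refine lintegral_congr fun g => ?_
    rw [← withDensity_apply _ hA, ← stdGaussian_map_add, Measure.map_apply (by fun_prop) hA]
    rfl
  have : IsProbabilityMeasure ((gaussianReal 0 1).map (fun g : ℝ => g • v)) :=
    Measure.isProbabilityMeasure_map (by fun_prop)
  rw [hconv]
  refine Measure.ext_of_charFun ?_
  ext t
  rw [charFun_conv, charFun_stdGaussian,
    charFun_multivariateGaussian (Matrix.PosSemidef.one.add (posSemidef_vecMulVec_self _))]
  have hmap : charFun ((gaussianReal 0 1).map (fun g : ℝ => g • v)) t =
      charFun (gaussianReal 0 1) ⟪v, t⟫ := by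
    rw [charFun_apply, charFun_apply, integral_map (by fun_prop)
      (Measurable.aestronglyMeasurable (by fun_prop))]
    simp [inner_smul_left, mul_comm]
  rw [hmap, charFun_gaussianReal, ← Complex.exp_add]
  congr 1
  rw [Matrix.add_mulVec, dotProduct_add, Matrix.one_mulVec, dotProduct_vecMulVec_self_mulVec,
    show t.ofLp ⬝ᵥ t.ofLp = ‖t‖ ^ 2 by
      rw [EuclideanSpace.real_norm_sq_eq]
      simp [dotProduct, sq]]
  push_cast
  simp
  ring

/-- For independent standard normals `g`, `g'`, the integral is `E exp(g g' ⟪v, w⟫)`. Integrating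
out one variable and then the other gives `(1 - ⟪v, w⟫²) ^ (-1/2)`. -/
lemma lintegral_spikedDensity_mul (v w : EuclideanSpace ℝ ι) (h : ⟪v, w⟫ ^ 2 ≤ 1 / 2) :
    ∫⁻ x, spikedDensity v x * spikedDensity w x ∂stdGaussian (EuclideanSpace ℝ ι) ≤
      ENNReal.ofReal (Real.exp (⟪v, w⟫ ^ 2)) := by
  have hm : ∀ v : EuclideanSpace ℝ ι, ∀ x, Measurable fun g : ℝ => shiftDensity (g • v) x :=
    fun v x => by unfold shiftDensity; fun_prop
  have hpt : ∀ x, spikedDensity v x * spikedDensity w x =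
      ∫⁻ q : ℝ × ℝ, shiftDensity (q.1 • v) x * shiftDensity (q.2 • w) x
        ∂(gaussianReal 0 1).prod (gaussianReal 0 1) := fun x =>
    (lintegral_prod_mul (hm v x).aemeasurable (hm w x).aemeasurable).symm
  simp_rw [hpt]
  rw [lintegral_lintegral_swap (by unfold shiftDensity; fun_prop)]
  simp_rw [lintegral_shiftDensity_mul]
  rw [lintegral_prod _ (by fun_prop)]
  have hin : ∀ g : ℝ, ∫⁻ g', ENNReal.ofReal (Real.exp ⟪g • v, g' • w⟫) ∂gaussianReal 0 1 =
      ENNReal.ofReal (Real.exp (⟪v, w⟫ ^ 2 * g ^ 2 / 2)) := by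
    intro g
    have hc : ∀ g' : ℝ, ⟪g • v, g' • w⟫ = (g * ⟪v, w⟫) * g' := fun g' => by
      rw [real_inner_smul_left, real_inner_smul_right]
      ring
    simp_rw [hc]
    rw [lintegral_exp_mul_gaussianReal]
    congr 2
    ring
  simp_rw [hin]
  rw [lintegral_exp_sq_gaussianReal (by linarith)]
  exact ENNReal.ofReal_le_ofReal (inv_sqrt_one_sub_le_exp (sq_nonneg _) h)

lemma multivariateGaussian_smul [DecidableEq ι] {a : ℝ} (ha : 0 ≤ a) {S : Matrix ι ι ℝ}
    (hS : S.PosSemidef) :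
    multivariateGaussian 0 (a • S) = (multivariateGaussian 0 S).map (fun x => √a • x) := by
  have : IsProbabilityMeasure ((multivariateGaussian 0 S).map (fun x => √a • x)) :=
    Measure.isProbabilityMeasure_map (by fun_prop)
  refine Measure.ext_of_charFun ?_
  ext t
  rw [charFun_map_smul, charFun_multivariateGaussian hS,
    charFun_multivariateGaussian (hS.smul ha)]
  congr 1
  simp [Matrix.smul_mulVec, Matrix.mulVec_smul]
  rw [← mul_assoc, ← Complex.ofReal_mul (√a) (√a), Real.mul_self_sqrt ha]

end Gaussian

/-! ### Reduction of minimax bounds to indistinguishable laws -/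

section Minimax

variable {n p : ℕ}

lemma opNorm_add_le (A B : Matrix (Fin p) (Fin p) ℝ) : opNorm (A + B) ≤ opNorm A + opNorm B := by
  unfold opNorm
  rw [map_add]
  exact norm_add_le _ _

lemma opNorm_neg (A : Matrix (Fin p) (Fin p) ℝ) : opNorm (-A) = opNorm A := by
  unfold opNorm
  rw [map_neg, norm_neg]

lemma opNorm_smul (c : ℝ) (A : Matrix (Fin p) (Fin p) ℝ) : opNorm (c • A) = |c| * opNorm A := by
  unfold opNorm
  rw [map_smul, norm_smul, Real.norm_eq_abs]

lemma opNorm_one_le : opNorm (1 : Matrix (Fin p) (Fin p) ℝ) ≤ 1 := by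
  unfold opNorm
  rw [map_one]
  exact ContinuousLinearMap.norm_id_le

lemma opNorm_vecMulVec_self {u : EuclideanSpace ℝ (Fin p)} (hu : ‖u‖ = 1) :
    opNorm (Matrix.vecMulVec u u) = 1 := by
  have happ : ∀ x, Matrix.toEuclideanCLM (n := Fin p) (𝕜 := ℝ) (Matrix.vecMulVec u u) x =
      ⟪u, x⟫ • u := by
    intro x
    ext i
    simp [Matrix.vecMulVec_mulVec, PiLp.inner_apply, dotProduct, mul_comm]
  refine le_antisymm (ContinuousLinearMap.opNorm_le_bound _ zero_le_one fun x => ?_) ?_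
  · rw [happ, norm_smul, hu, mul_one, one_mul]
    simpa [hu] using norm_inner_le_norm (𝕜 := ℝ) u x
  · have := (Matrix.toEuclideanCLM (n := Fin p) (𝕜 := ℝ) (Matrix.vecMulVec u u)).le_opNorm u
    rw [happ, real_inner_self_eq_norm_sq, hu, one_pow, one_smul, hu, mul_one] at this
    exact this

lemma measurableSet_opNorm_sub {T : (Fin n → EuclideanSpace ℝ (Fin p)) → Matrix (Fin p) (Fin p) ℝ}
    (hT : IsEstimator T) (S : Matrix (Fin p) (Fin p) ℝ) (r : ℝ) :
    MeasurableSet {x | r ≤ opNorm (T x - S) ^ 2} := by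
  have hcont : Continuous fun A : Fin p → Fin p → ℝ => opNorm (Matrix.of A) := by
    have hl : Continuous ((Matrix.toEuclideanCLM (n := Fin p) (𝕜 := ℝ)).toAlgEquiv.toLinearMap ∘ₗ
        (Matrix.ofLinearEquiv ℝ : (Fin p → Fin p → ℝ) ≃ₗ[ℝ] _).toLinearMap) :=
      LinearMap.continuous_of_finiteDimensional _
    exact hl.norm
  have hmeas : Measurable fun x => (fun i j => T x i j - S i j : Fin p → Fin p → ℝ) :=
    measurable_pi_iff.2 fun i => measurable_pi_iff.2 fun j => (hT i j).sub_const _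
  exact measurableSet_le measurable_const ((hcont.measurable.comp hmeas).pow_const 2)

/-- By the triangle inequality, an estimate cannot be close to two well separated matrices. -/
lemma le_sq_opNorm_sub_of_lt {A S S' : Matrix (Fin p) (Fin p) ℝ} {d : ℝ}
    (hd : 0 ≤ d) (hS : 2 * d ≤ opNorm (S - S')) (h : ¬ d ^ 2 ≤ opNorm (A - S) ^ 2) :
    d ^ 2 ≤ opNorm (A - S') ^ 2 := by
  have h1 : opNorm (A - S) < d := lt_of_pow_lt_pow_left₀ 2 hd (not_le.1 h)
  have h2 : opNorm (S - S') ≤ opNorm (A - S') + opNorm (A - S) := by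
    have := opNorm_add_le (A - S') (-(A - S))
    rw [opNorm_neg] at this
    convert this using 2
    abel
  exact pow_le_pow_left₀ hd (by linarith) 2

lemma minimaxProb_antitone (Θ : Set (Matrix (Fin p) (Fin p) ℝ)) (ε : ℝ) {r r' : ℝ} (h : r ≤ r') :
    minimaxProb n Θ ε r' ≤ minimaxProb n Θ ε r :=
  iInf₂_mono fun _ _ => iSup₂_mono fun _ _ => iSup_mono fun _ =>
    measure_mono fun _ hx => h.trans hx

lemma le_minimaxProb {Θ : Set (Matrix (Fin p) (Fin p) ℝ)} {ε r : ℝ} {c : ℝ≥0∞}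
    (h : ∀ T : (Fin n → EuclideanSpace ℝ (Fin p)) → Matrix (Fin p) (Fin p) ℝ, IsEstimator T →
      ∃ S ∈ Θ, ∃ Q : ProbabilityMeasure (EuclideanSpace ℝ (Fin p)),
        c ≤ sampleLaw n ε S (Q : Measure (EuclideanSpace ℝ (Fin p)))
          {x | r ≤ opNorm (T x - S) ^ 2}) :
    c ≤ minimaxProb n Θ ε r := by
  refine le_iInf₂ fun T hT => ?_
  obtain ⟨S, hS, Q, hQ⟩ := h T hT
  exact le_iSup₂_of_le S hS (le_iSup_of_le Q hQ)

/-- The centred Gaussian law as an element of the space of probability measures. -/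
noncomputable def gaussianLaw (S : Matrix (Fin p) (Fin p) ℝ) :
    ProbabilityMeasure (EuclideanSpace ℝ (Fin p)) :=
  ⟨multivariateGaussian 0 S, inferInstance⟩

/-- Choosing `Q` equal to the model law removes the contamination, so lower bounds for clean data
hold at every `ε`. -/
lemma contaminated_gaussianLaw {ε : ℝ} (h0 : 0 ≤ ε) (h1 : ε ≤ 1) (S : Matrix (Fin p) (Fin p) ℝ) :
    contaminated ε S (gaussianLaw S : Measure (EuclideanSpace ℝ (Fin p))) =
      multivariateGaussian 0 S := by
  change ENNReal.ofReal (1 - ε) • multivariateGaussian 0 S +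
    ENNReal.ofReal ε • multivariateGaussian 0 S = _
  rw [← add_smul, ← ENNReal.ofReal_add (by linarith) h0]
  simp

lemma pi_map_smul (a : ℝ) (μ : Measure (EuclideanSpace ℝ (Fin p))) [IsProbabilityMeasure μ] :
    Measure.pi (fun _ : Fin n => μ.map (fun x => a • x)) =
      (Measure.pi fun _ : Fin n => μ).map (fun x i => a • x i) := by
  have : IsProbabilityMeasure (μ.map (fun x => a • x)) :=
    Measure.isProbabilityMeasure_map (by fun_prop)
  exact (Measure.pi_map_pi (μ := fun _ : Fin n => μ) (f := fun _ x => a • x)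
    (fun _ => by fun_prop)).symm

/-- Lower bound from a spiked covariance model whose spike has a finite uniform prior. -/
lemma le_minimaxProb_of_spikes {J : Type*} [Fintype J] [Nonempty J]
    {Θ : Set (Matrix (Fin p) (Fin p) ℝ)} {ε a δ : ℝ} (hε0 : 0 ≤ ε) (hε1 : ε ≤ 1) (ha : 0 ≤ a)
    (hδ0 : 0 ≤ δ) (hδ : δ ^ 2 ≤ 1 / 2) {u : J → EuclideanSpace ℝ (Fin p)} (hu : ∀ j, ‖u j‖ = 1)
    (hsecond : ∑ j, ∑ l, Real.exp (n * δ ^ 2 * ⟪u j, u l⟫ ^ 2) ≤ 2 * (Fintype.card J : ℝ) ^ 2)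
    (h0 : a • (1 : Matrix (Fin p) (Fin p) ℝ) ∈ Θ)
    (h1 : ∀ j, a • (1 + δ • Matrix.vecMulVec (u j) (u j)) ∈ Θ) :
    ENNReal.ofReal (1 / 8) ≤ minimaxProb n Θ ε ((a * δ / 2) ^ 2) := by
  refine le_minimaxProb fun T hT => ?_
  -- The factor `√δ` turns `v vᵀ` into `δ u uᵀ`, so squared inner products carry `δ²`.
  set v : J → EuclideanSpace ℝ (Fin p) := fun j => √δ • u j with hv
  have hvv : ∀ j, Matrix.vecMulVec (v j) (v j) = δ • Matrix.vecMulVec (u j) (u j) := by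
    intro j
    ext i k
    simp only [hv, Matrix.vecMulVec_apply, PiLp.smul_apply, Matrix.smul_apply, smul_eq_mul]
    linear_combination (u j i * u j k) * Real.mul_self_sqrt hδ0
  have hin : ∀ j l, ⟪v j, v l⟫ ^ 2 = δ ^ 2 * ⟪u j, u l⟫ ^ 2 := by
    intro j l
    simp only [hv]
    rw [real_inner_smul_left, real_inner_smul_right, ← mul_assoc, Real.mul_self_sqrt hδ0, mul_pow]
  have hin1 : ∀ j l, ⟪v j, v l⟫ ^ 2 ≤ 1 / 2 := by
    intro j l
    rw [hin]
    have h := abs_real_inner_le_norm (u j) (u l)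
    rw [hu, hu, mul_one] at h
    have h' := (sq_le_one_iff_abs_le_one _).2 h
    nlinarith [sq_nonneg δ]
  -- Rescaling by `√a` reduces to base covariance `I`, where the likelihood ratios were computed.
  set φ : (Fin n → EuclideanSpace ℝ (Fin p)) → Fin n → EuclideanSpace ℝ (Fin p) :=
    fun x i => √a • x i with hφ
  have hφm : Measurable φ := by fun_prop
  set μ := Measure.pi fun _ : Fin n => stdGaussian (EuclideanSpace ℝ (Fin p)) with hμ
  set f : J → (Fin n → EuclideanSpace ℝ (Fin p)) → ℝ≥0∞ :=
    fun j x => ∏ i, spikedDensity (v j) (x i) with hf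
  have hfm : ∀ j, Measurable (f j) := fun j =>
    Finset.measurable_prod _ fun i _ => (measurable_spikedDensity (v j)).comp (measurable_pi_apply i)
  have hprob1 : ∀ j, IsProbabilityMeasure
      ((stdGaussian (EuclideanSpace ℝ (Fin p))).withDensity (spikedDensity (v j))) := fun j => by
    rw [withDensity_spikedDensity]
    infer_instance
  have hpi : ∀ j, μ.withDensity (f j) =
      Measure.pi fun _ : Fin n => multivariateGaussian 0 (1 + Matrix.vecMulVec (v j) (v j)) := by
    intro j
    simp_rw [← withDensity_spikedDensity]
    exact (pi_withDensity (fun _ : Fin n => stdGaussian (EuclideanSpace ℝ (Fin p)))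
      (fun _ => measurable_spikedDensity (v j))).symm
  have hprob : ∀ j, IsProbabilityMeasure (μ.withDensity (f j)) := fun j => by
    rw [hpi]
    infer_instance
  have hff : ∀ j l, ∫⁻ x, f j x * f l x ∂μ ≤
      ENNReal.ofReal (Real.exp (n * δ ^ 2 * ⟪u j, u l⟫ ^ 2)) := by
    intro j l
    simp_rw [hf, ← Finset.prod_mul_distrib]
    rw [lintegral_pi_prod (fun _ : Fin n => stdGaussian (EuclideanSpace ℝ (Fin p)))
      (f := fun _ x => spikedDensity (v j) x * spikedDensity (v l) x)
      (fun _ => (measurable_spikedDensity _).mul (measurable_spikedDensity _)),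
      Finset.prod_const, Finset.card_univ, Fintype.card_fin]
    refine (pow_le_pow_left₀ zero_le (lintegral_spikedDensity_mul _ _ (hin1 j l)) n).trans ?_
    rw [← ENNReal.ofReal_pow (Real.exp_pos _).le, ← Real.exp_nat_mul, hin, mul_assoc]
  have hsum : ∑ j, ∑ l, ∫⁻ x, f j x * f l x ∂μ ≤ 2 * (Fintype.card J : ℝ≥0∞) ^ 2 := by
    calc ∑ j, ∑ l, ∫⁻ x, f j x * f l x ∂μ
        ≤ ∑ j, ∑ l, ENNReal.ofReal (Real.exp (n * δ ^ 2 * ⟪u j, u l⟫ ^ 2)) :=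
          Finset.sum_le_sum fun j _ => Finset.sum_le_sum fun l _ => hff j l
      _ = ENNReal.ofReal (∑ j, ∑ l, Real.exp (n * δ ^ 2 * ⟪u j, u l⟫ ^ 2)) := by
          rw [ENNReal.ofReal_sum_of_nonneg fun j _ => Finset.sum_nonneg fun l _ => (Real.exp_pos _).le]
          refine Finset.sum_congr rfl fun j _ => ?_
          rw [ENNReal.ofReal_sum_of_nonneg fun l _ => (Real.exp_pos _).le]
      _ ≤ ENNReal.ofReal (2 * (Fintype.card J : ℝ) ^ 2) := ENNReal.ofReal_le_ofReal hsecond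
      _ = 2 * (Fintype.card J : ℝ≥0∞) ^ 2 := by
          rw [ENNReal.ofReal_mul (by norm_num), ENNReal.ofReal_pow (by positivity)]
          simp
  have hlaw0 : sampleLaw n ε (a • 1) (gaussianLaw (a • (1 : Matrix (Fin p) (Fin p) ℝ)) :
      Measure (EuclideanSpace ℝ (Fin p))) = μ.map φ := by
    simp_rw [sampleLaw, contaminated_gaussianLaw hε0 hε1,
      multivariateGaussian_smul ha Matrix.PosSemidef.one, multivariateGaussian_zero_one]
    exact pi_map_smul _ _
  have hlaw1 : ∀ j, sampleLaw n ε (a • (1 + δ • Matrix.vecMulVec (u j) (u j)))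
      (gaussianLaw (a • (1 + δ • Matrix.vecMulVec (u j) (u j))) :
        Measure (EuclideanSpace ℝ (Fin p))) = (μ.withDensity (f j)).map φ := by
    intro j
    simp_rw [sampleLaw, contaminated_gaussianLaw hε0 hε1, hpi, ← hvv,
      multivariateGaussian_smul ha (Matrix.PosSemidef.one.add (posSemidef_vecMulVec_self _))]
    exact pi_map_smul _ _
  have hdist : ∀ j, 2 * (a * δ / 2) ≤
      opNorm (a • 1 - a • (1 + δ • Matrix.vecMulVec (u j) (u j))) := by
    intro j
    have : a • 1 - a • (1 + δ • Matrix.vecMulVec (u j) (u j)) =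
        (-(a * δ)) • Matrix.vecMulVec (u j) (u j) := by
      rw [smul_add, smul_smul, neg_smul]
      abel
    rw [this, opNorm_smul, opNorm_vecMulVec_self (hu j), abs_neg, abs_of_nonneg (by positivity)]
    linarith
  have hm0 := measurableSet_opNorm_sub hT (a • 1) ((a * δ / 2) ^ 2)
  -- Here `A` is the event that `T` misses the null matrix; off `A` it is within `a δ / 2` of it,
  -- hence misses every spike.
  rcases exists_le_of_second_moment μ hfm hprob hsum (hφm hm0)
    (B := fun j => φ ⁻¹' {x | (a * δ / 2) ^ 2 ≤
      opNorm (T x - a • (1 + δ • Matrix.vecMulVec (u j) (u j))) ^ 2})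
    (fun j x hx => by
      rw [Set.mem_preimage, Set.mem_ofPred_eq]
      exact le_sq_opNorm_sub_of_lt (by positivity) (hdist j) hx) with h | ⟨j, h⟩
  · refine ⟨_, h0, gaussianLaw (a • 1), ?_⟩
    rwa [hlaw0, Measure.map_apply hφm hm0]
  · refine ⟨_, h1 j, gaussianLaw (a • (1 + δ • Matrix.vecMulVec (u j) (u j))), ?_⟩
    rwa [hlaw1, Measure.map_apply hφm (measurableSet_opNorm_sub hT _ _)]

lemma multivariateGaussian_smul_vecMulVec {c : ℝ} (hc : 0 ≤ c) (u : EuclideanSpace ℝ (Fin p)) :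
    multivariateGaussian 0 (c • Matrix.vecMulVec u u) =
      (gaussianReal 0 c.toNNReal).map (fun g => g • u) := by
  have : IsProbabilityMeasure ((gaussianReal 0 c.toNNReal).map (fun g : ℝ => g • u)) :=
    Measure.isProbabilityMeasure_map (by fun_prop)
  refine Measure.ext_of_charFun ?_
  ext t
  have hmap : charFun ((gaussianReal 0 c.toNNReal).map (fun g => g • u)) t =
      charFun (gaussianReal 0 c.toNNReal) ⟪u, t⟫ := by
    rw [charFun_apply, charFun_apply, integral_map (by fun_prop)
      (Measurable.aestronglyMeasurable (by fun_prop))]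
    simp [inner_smul_left, mul_comm]
  rw [hmap, charFun_gaussianReal,
    charFun_multivariateGaussian ((posSemidef_vecMulVec_self _).smul hc)]
  congr 1
  rw [Matrix.smul_mulVec, dotProduct_smul, dotProduct_vecMulVec_self_mulVec, smul_eq_mul,
    Real.coe_toNNReal _ hc]
  push_cast
  simp

/-- Enlarging the variance divides the normalising constant by `1 + ε`, which costs no more than `1
- ε` does because `(1 - ε) (1 + ε) ≤ 1`; the exponential factor only grows. -/
lemma smul_gaussianReal_le {a ε : ℝ} (ha : 0 < a) (h0 : 0 ≤ ε) (h1 : ε ≤ 1) :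
    ENNReal.ofReal (1 - ε) • gaussianReal 0 a.toNNReal ≤
      gaussianReal 0 (a * (1 + ε) ^ 2).toNNReal := by
  have hb : 0 < a * (1 + ε) ^ 2 := by positivity
  rw [gaussianReal_of_var_ne_zero _ (by simpa using ha),
    gaussianReal_of_var_ne_zero _ (by simpa using hb),
    ← withDensity_smul _ (measurable_gaussianPDF _ _)]
  refine withDensity_mono (Filter.Eventually.of_forall fun x => ?_)
  rw [Pi.smul_apply, smul_eq_mul, gaussianPDF, gaussianPDF, ← ENNReal.ofReal_mul (by linarith)]
  refine ENNReal.ofReal_le_ofReal ?_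
  rw [gaussianPDFReal, gaussianPDFReal, Real.coe_toNNReal _ ha.le, Real.coe_toNNReal _ hb.le,
    ← mul_assoc]
  refine mul_le_mul ?_ (Real.exp_le_exp.2 ?_) (Real.exp_pos _).le (by positivity)
  · rw [← mul_assoc, Real.sqrt_mul (by positivity) ((1 + ε) ^ 2), Real.sqrt_sq (by linarith), mul_inv,
      mul_comm]
    refine mul_le_mul_of_nonneg_left ?_ (by positivity)
    rw [← one_div, le_div_iff₀ (by linarith)]
    nlinarith
  · rw [neg_div, neg_div, neg_le_neg_iff]
    refine div_le_div_of_nonneg_left (sq_nonneg _) (by positivity) ?_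
    nlinarith [mul_nonneg ha.le h0, mul_nonneg ha.le (sq_nonneg ε)]

/-- A contaminating law that hides a small increase of a variance. -/
lemma exists_contaminated_eq {a ε : ℝ} (ha : 0 < a) (h0 : 0 < ε) (h1 : ε ≤ 1)
    (u : EuclideanSpace ℝ (Fin p)) :
    ∃ Q : ProbabilityMeasure (EuclideanSpace ℝ (Fin p)),
      contaminated ε (a • Matrix.vecMulVec u u) (Q : Measure (EuclideanSpace ℝ (Fin p))) =
        multivariateGaussian 0 ((a * (1 + ε) ^ 2) • Matrix.vecMulVec u u) := by
  set ν := ENNReal.ofReal (1 - ε) • multivariateGaussian 0 (a • Matrix.vecMulVec u u) with hν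
  set ρ := multivariateGaussian 0 ((a * (1 + ε) ^ 2) • Matrix.vecMulVec u u) with hρ
  have hle : ν ≤ ρ := by
    rw [hν, hρ, multivariateGaussian_smul_vecMulVec ha.le,
      multivariateGaussian_smul_vecMulVec (by positivity), ← Measure.map_smul]
    exact Measure.map_mono (smul_gaussianReal_le ha h0.le h1) (by fun_prop)
  have hfin : IsFiniteMeasure ν := isFiniteMeasure_of_le ρ hle
  have hε : ENNReal.ofReal ε ≠ 0 := by simpa using h0
  have hmass : (ρ - ν) Set.univ = ENNReal.ofReal ε := by
    rw [Measure.sub_apply MeasurableSet.univ hle, measure_univ, hν, Measure.smul_apply,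
      measure_univ, smul_eq_mul, mul_one, ← ENNReal.ofReal_one,
      ← ENNReal.ofReal_sub _ (by linarith)]
    congr 1
    ring
  -- `Q` is the excess `ρ - ν`, of mass `ε`, normalised.
  refine ⟨⟨(ENNReal.ofReal ε)⁻¹ • (ρ - ν), ⟨?_⟩⟩, ?_⟩
  · rw [Measure.smul_apply, hmass, smul_eq_mul, ENNReal.inv_mul_cancel hε ENNReal.ofReal_ne_top]
  · change ν + ENNReal.ofReal ε • ((ENNReal.ofReal ε)⁻¹ • (ρ - ν)) = ρ
    rw [smul_smul, ENNReal.mul_inv_cancel hε ENNReal.ofReal_ne_top, one_smul, add_comm,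
      Measure.sub_add_cancel_of_le hle]

/-- The clean law at the larger matrix equals a contaminated law at the smaller one. Under this
common law the two error events cover the space, so one has probability at least `1/2`. -/
lemma le_minimaxProb_of_contamination {Θ : Set (Matrix (Fin p) (Fin p) ℝ)} {ε a : ℝ}
    (hε0 : 0 < ε) (hε1 : ε ≤ 1) (ha : 0 < a) {u : EuclideanSpace ℝ (Fin p)} (hu : ‖u‖ = 1)
    (h0 : a • Matrix.vecMulVec u u ∈ Θ)
    (h1 : (a * (1 + ε) ^ 2) • Matrix.vecMulVec u u ∈ Θ) :
    ENNReal.ofReal (1 / 2) ≤ minimaxProb n Θ ε ((a * ε) ^ 2) := by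
  refine le_minimaxProb fun T hT => ?_
  obtain ⟨Q, hQ⟩ := exists_contaminated_eq ha hε0 hε1 u
  set S := a • Matrix.vecMulVec u u with hS
  set S' := (a * (1 + ε) ^ 2) • Matrix.vecMulVec u u with hS'
  have hlaw : sampleLaw n ε S' (gaussianLaw S' : Measure (EuclideanSpace ℝ (Fin p))) =
      sampleLaw n ε S (Q : Measure (EuclideanSpace ℝ (Fin p))) := by
    rw [sampleLaw, sampleLaw, contaminated_gaussianLaw hε0.le hε1, hQ]
  have hprob : IsProbabilityMeasure (sampleLaw n ε S (Q : Measure (EuclideanSpace ℝ (Fin p)))) := by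
    rw [sampleLaw, hQ]
    infer_instance
  have hdist : 2 * (a * ε) ≤ opNorm (S - S') := by
    rw [hS, hS', ← sub_smul, opNorm_smul, opNorm_vecMulVec_self hu, mul_one, abs_sub_comm]
    refine le_trans ?_ (le_abs_self _)
    nlinarith [mul_nonneg ha.le (sq_nonneg ε)]
  by_contra! hcon
  have hA := hcon S h0 Q
  have hB := hcon S' h1 (gaussianLaw S')
  rw [hlaw] at hB
  have hcover : (Set.univ : Set (Fin n → EuclideanSpace ℝ (Fin p))) ⊆
      {x | (a * ε) ^ 2 ≤ opNorm (T x - S) ^ 2} ∪ {x | (a * ε) ^ 2 ≤ opNorm (T x - S') ^ 2} := by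
    intro x _
    by_cases hx : (a * ε) ^ 2 ≤ opNorm (T x - S) ^ 2
    · exact Or.inl hx
    · exact Or.inr (le_sq_opNorm_sub_of_lt (by positivity) hdist hx)
  have h := (measure_mono hcover).trans (measure_union_le _ _)
    |>.trans_lt (ENNReal.add_lt_add hA hB)
  rw [measure_univ, ← ENNReal.ofReal_add (by norm_num) (by norm_num)] at h
  norm_num at h

end Minimax

/-! ### Second moments for random sign and coordinate priors -/

section Priors

/-- The sign encoded by a Boolean. -/
def signOf (b : Bool) : ℝ := if b then 1 else -1

lemma signOf_sq (b : Bool) : signOf b ^ 2 = 1 := by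
  cases b <;> simp [signOf]

lemma abs_signOf (b : Bool) : |signOf b| = 1 := by
  cases b <;> simp [signOf]

variable {ι : Type*} [Fintype ι] [DecidableEq ι]

/-- The sum factors over coordinates and `cosh b ≤ exp(b² / 2)`: random signs are sub-Gaussian. -/
lemma sum_exp_sign_le (b : ι → ℝ) :
    ∑ s : ι → Bool, Real.exp (∑ i, signOf (s i) * b i) ≤
      2 ^ Fintype.card ι * Real.exp ((∑ i, b i ^ 2) / 2) := by
  have hcosh : ∀ i, ∑ s : Bool, Real.exp (signOf s * b i) ≤ 2 * Real.exp (b i ^ 2 / 2) := by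
    intro i
    have h := Real.cosh_le_exp_half_sq (b i)
    rw [Real.cosh_eq] at h
    simp only [Fintype.sum_bool, signOf, if_true, Bool.false_eq_true, if_false, one_mul, neg_mul]
    linarith
  calc ∑ s : ι → Bool, Real.exp (∑ i, signOf (s i) * b i)
      = ∏ i, ∑ s : Bool, Real.exp (signOf s * b i) := by
        simp_rw [Real.exp_sum]
        rw [Finset.prod_univ_sum, Fintype.piFinset_univ]
    _ ≤ ∏ i, (2 * Real.exp (b i ^ 2 / 2)) :=
        Finset.prod_le_prod (fun i _ => Finset.sum_nonneg fun _ _ => (Real.exp_pos _).le)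
          fun i _ => hcosh i
    _ = _ := by
        rw [Finset.prod_mul_distrib, ← Real.exp_sum, ← Finset.sum_div, Finset.prod_const,
          Finset.card_univ]

/-- The square is linearised by an auxiliary Gaussian: `exp(c x²) = E exp(√(2 c) g x)`. For fixed
`g` and `s'` the exponent is linear in the signs `s`, and its squared coefficients do not depend on
`s'`. The sub-Gaussian bound then leaves `E exp(c q g²) = (1 - 2 c q) ^ (-1/2)`, at most 2 since `2
c q ≤ 1/2`. -/
lemma sum_exp_sq_sign_le (w : ι → ℝ) {c : ℝ} (hc0 : 0 ≤ c) (hc : c * ∑ i, w i ^ 4 ≤ 1 / 4) :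
    ∑ s : ι → Bool, ∑ s' : ι → Bool,
        Real.exp (c * (∑ i, signOf (s i) * signOf (s' i) * w i ^ 2) ^ 2) ≤
      2 * (Fintype.card (ι → Bool) : ℝ) ^ 2 := by
  set N : ℝ := (Fintype.card (ι → Bool) : ℝ) with hN
  have hN' : N = 2 ^ Fintype.card ι := by simp [hN]
  set q := ∑ i, w i ^ 4 with hq
  set τ := √(2 * c) with hτ
  have hτ2 : τ ^ 2 = 2 * c := Real.sq_sqrt (by positivity)
  set D : (ι → Bool) → (ι → Bool) → ℝ := fun s s' => ∑ i, signOf (s i) * signOf (s' i) * w i ^ 2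
    with hD
  have hpt : ∀ t : ℝ, ∑ s, ∑ s', Real.exp (t * D s s') ≤ N ^ 2 * Real.exp (t ^ 2 * q / 2) := by
    intro t
    rw [Finset.sum_comm]
    have hin : ∀ s', ∑ s, Real.exp (t * D s s') ≤ N * Real.exp (t ^ 2 * q / 2) := by
      intro s'
      have h := sum_exp_sign_le fun i => t * (signOf (s' i) * w i ^ 2)
      have h1 : ∀ s : ι → Bool, ∑ i, signOf (s i) * (t * (signOf (s' i) * w i ^ 2)) = t * D s s' := by
        intro s
        rw [hD, Finset.mul_sum]
        exact Finset.sum_congr rfl fun i _ => by ring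
      have h2 : ∑ i, (t * (signOf (s' i) * w i ^ 2)) ^ 2 = t ^ 2 * q := by
        rw [hq, Finset.mul_sum]
        refine Finset.sum_congr rfl fun i _ => ?_
        linear_combination t ^ 2 * w i ^ 4 * signOf_sq (s' i)
      simp_rw [h1, h2, ← hN'] at h
      exact h
    calc ∑ s', ∑ s, Real.exp (t * D s s') ≤ ∑ _s' : ι → Bool, N * Real.exp (t ^ 2 * q / 2) :=
          Finset.sum_le_sum fun s' _ => hin s'
      _ = N ^ 2 * Real.exp (t ^ 2 * q / 2) := by
          rw [Finset.sum_const, Finset.card_univ, nsmul_eq_mul, ← hN]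
          ring
  have hexp : ∀ x : ℝ, ENNReal.ofReal (Real.exp (c * x ^ 2)) =
      ∫⁻ g, ENNReal.ofReal (Real.exp (τ * g * x)) ∂gaussianReal 0 1 := by
    intro x
    have h := lintegral_exp_mul_gaussianReal (τ * x)
    rw [mul_pow, hτ2, show 2 * c * x ^ 2 / 2 = c * x ^ 2 by ring] at h
    rw [← h]
    refine lintegral_congr fun g => ?_
    congr 2
    ring
  refine (ENNReal.ofReal_le_ofReal_iff (by positivity)).1 ?_
  calc ENNReal.ofReal (∑ s, ∑ s', Real.exp (c * D s s' ^ 2))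
      = ∑ s, ∑ s', ∫⁻ g, ENNReal.ofReal (Real.exp (τ * g * D s s')) ∂gaussianReal 0 1 := by
        rw [ENNReal.ofReal_sum_of_nonneg fun j _ => Finset.sum_nonneg fun l _ => (Real.exp_pos _).le]
        refine Finset.sum_congr rfl fun j _ => ?_
        rw [ENNReal.ofReal_sum_of_nonneg fun l _ => (Real.exp_pos _).le]
        exact Finset.sum_congr rfl fun l _ => hexp _
    _ = ∫⁻ g, ∑ s, ∑ s', ENNReal.ofReal (Real.exp (τ * g * D s s')) ∂gaussianReal 0 1 := by
        rw [lintegral_finsetSum _ fun s _ => by fun_prop]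
        refine Finset.sum_congr rfl fun s _ => ?_
        rw [lintegral_finsetSum _ fun s' _ => by fun_prop]
    _ ≤ ∫⁻ g, ENNReal.ofReal (N ^ 2) * ENNReal.ofReal (Real.exp (2 * c * q * g ^ 2 / 2))
          ∂gaussianReal 0 1 := by
        refine lintegral_mono fun g => ?_
        rw [← ENNReal.ofReal_mul (by positivity)]
        calc ∑ s, ∑ s', ENNReal.ofReal (Real.exp (τ * g * D s s'))
            = ENNReal.ofReal (∑ s, ∑ s', Real.exp (τ * g * D s s')) := by
              rw [ENNReal.ofReal_sum_of_nonneg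
                fun j _ => Finset.sum_nonneg fun l _ => (Real.exp_pos _).le]
              refine Finset.sum_congr rfl fun j _ => ?_
              rw [ENNReal.ofReal_sum_of_nonneg fun l _ => (Real.exp_pos _).le]
          _ ≤ _ := by
              refine ENNReal.ofReal_le_ofReal ((hpt _).trans (le_of_eq ?_))
              rw [mul_pow, hτ2]
              congr 2
              ring
    _ = ENNReal.ofReal (N ^ 2) * ENNReal.ofReal ((√(1 - 2 * c * q))⁻¹) := by
        rw [lintegral_const_mul _ (by fun_prop), lintegral_exp_sq_gaussianReal (by linarith)]
    _ ≤ ENNReal.ofReal (2 * N ^ 2) := by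
        rw [← ENNReal.ofReal_mul (by positivity)]
        refine ENNReal.ofReal_le_ofReal ?_
        rw [mul_comm]
        exact mul_le_mul_of_nonneg_right (inv_sqrt_one_sub_le_two (by linarith)) (by positivity)

/-- Distinct basis vectors are orthogonal and contribute 1; only the `p` diagonal terms contribute
`exp c ≤ p`. -/
lemma sum_exp_basis_le {p : ℕ} {c : ℝ} (hc : Real.exp c ≤ p) :
    ∑ j : Fin p, ∑ l : Fin p, Real.exp (c * ⟪EuclideanSpace.single j (1 : ℝ),
      EuclideanSpace.single l (1 : ℝ)⟫ ^ 2) ≤ 2 * (Fintype.card (Fin p) : ℝ) ^ 2 := by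
  have hterm : ∀ j l : Fin p, Real.exp (c * ⟪EuclideanSpace.single j (1 : ℝ),
      EuclideanSpace.single l (1 : ℝ)⟫ ^ 2) ≤ 1 + if j = l then Real.exp c else 0 := by
    intro j l
    by_cases h : j = l
    · subst h
      simp
    · simp [EuclideanSpace.inner_single_left, h]
  calc _ ≤ ∑ j : Fin p, ∑ l : Fin p, (1 + if j = l then Real.exp c else 0) :=
        Finset.sum_le_sum fun j _ => Finset.sum_le_sum fun l _ => hterm j l
    _ = (p : ℝ) * (p + Real.exp c) := by simp [Finset.sum_add_distrib, mul_add]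
    _ ≤ 2 * (Fintype.card (Fin p) : ℝ) ^ 2 := by
        rw [Fintype.card_fin]
        nlinarith [(Nat.cast_nonneg p : (0 : ℝ) ≤ p)]

end Priors

/-! ### Membership in the matrix classes and the three terms of the rate -/

section Classes

variable {n p : ℕ} {Θ : Set (Matrix (Fin p) (Fin p) ℝ)} {M ε : ℝ}

lemma smul_one_mem_boundedClass (hM : 0 ≤ M) :
    (M / 2) • (1 : Matrix (Fin p) (Fin p) ℝ) ∈ boundedClass p M := by
  refine ⟨Matrix.PosSemidef.one.smul (by positivity), ?_⟩
  rw [opNorm_smul, abs_of_nonneg (by positivity)]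
  nlinarith [opNorm_one_le (p := p)]

/-- The level `M / 2` leaves room for the spike, as `(M / 2) (1 + δ) ≤ M`. -/
lemma spike_mem_boundedClass (hM : 0 ≤ M) {δ : ℝ} (hδ0 : 0 ≤ δ) (hδ1 : δ ≤ 1)
    {u : EuclideanSpace ℝ (Fin p)} (hu : ‖u‖ = 1) :
    (M / 2) • (1 + δ • Matrix.vecMulVec u u) ∈ boundedClass p M := by
  refine ⟨(Matrix.PosSemidef.one.add ((posSemidef_vecMulVec_self _).smul hδ0)).smul
    (by positivity), ?_⟩
  have h := opNorm_add_le 1 (δ • Matrix.vecMulVec u u)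
  rw [opNorm_smul, opNorm_vecMulVec_self hu, abs_of_nonneg hδ0] at h
  rw [opNorm_smul, abs_of_nonneg (by positivity)]
  nlinarith [opNorm_one_le (p := p)]

lemma smul_vecMulVec_mem_boundedClass {c : ℝ} (hc0 : 0 ≤ c) (hc : c ≤ M)
    {u : EuclideanSpace ℝ (Fin p)} (hu : ‖u‖ = 1) :
    c • Matrix.vecMulVec u u ∈ boundedClass p M := by
  refine ⟨(posSemidef_vecMulVec_self _).smul hc0, ?_⟩
  rwa [opNorm_smul, opNorm_vecMulVec_self hu, abs_of_nonneg hc0, mul_one]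

lemma vecMulVec_single_offDiag (l : Fin p) {i j : Fin p} (hij : i ≠ j) :
    Matrix.vecMulVec (EuclideanSpace.single l (1 : ℝ)) (EuclideanSpace.single l (1 : ℝ)) i j = 0 := by
  rw [Matrix.vecMulVec_apply]
  by_cases h : i = l
  · have : j ≠ l := fun h' => hij (h.trans h'.symm)
    simp [this]
  · simp [h]

/-- The contamination term of the minimax rate, for any class containing the diagonal matrices
with bounded entries. -/
lemma le_minimaxProb_eps (hp : 1 ≤ p) (hM : 0 < M) (hε0 : 0 ≤ ε) (hε1 : ε ≤ 1)
    (hΘ : ∀ S ∈ boundedClass p M, (∀ i j, i ≠ j → S i j = 0) → S ∈ Θ) :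
    ENNReal.ofReal (1 / 8) ≤ minimaxProb n Θ ε ((M / 4) ^ 2 * ε ^ 2) := by
  set l : Fin p := ⟨0, hp⟩
  have hu : ‖EuclideanSpace.single l (1 : ℝ)‖ = 1 := by simp
  have hmem : ∀ c, 0 ≤ c → c ≤ M → c • Matrix.vecMulVec (EuclideanSpace.single l (1 : ℝ))
      (EuclideanSpace.single l (1 : ℝ)) ∈ Θ := fun c h0 h1 =>
    hΘ _ (smul_vecMulVec_mem_boundedClass h0 h1 hu) fun i j hij => by
      rw [Matrix.smul_apply, vecMulVec_single_offDiag l hij, smul_zero]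
  -- At `ε = 0` the threshold is zero and the event is everything; the hiding law needs division by
  -- `ε`.
  rcases hε0.eq_or_lt with rfl | hε
  · set S := M • Matrix.vecMulVec (EuclideanSpace.single l (1 : ℝ))
      (EuclideanSpace.single l (1 : ℝ))
    refine le_minimaxProb fun T _ => ⟨S, hmem M hM.le le_rfl, gaussianLaw S, ?_⟩
    have hprob : IsProbabilityMeasure
        (sampleLaw n 0 S (gaussianLaw S : Measure (EuclideanSpace ℝ (Fin p)))) := by
      rw [sampleLaw, contaminated_gaussianLaw le_rfl zero_le_one]
      infer_instance
    have huniv : {x | (M / 4) ^ 2 * (0 : ℝ) ^ 2 ≤ opNorm (T x - S) ^ 2} = Set.univ :=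
      Set.eq_univ_of_forall fun x => by
        rw [Set.mem_ofPred_eq]
        simpa using sq_nonneg (opNorm (T x - S))
    rw [huniv, measure_univ, ENNReal.ofReal_le_one]
    norm_num
  · rw [← mul_pow]
    -- The level `a = M / 4` is chosen because `(1 + ε)² ≤ 4`.
    refine le_trans (ENNReal.ofReal_le_ofReal (by norm_num))
      (le_minimaxProb_of_contamination hε hε1 (by positivity) hu (hmem _ (by positivity) (by linarith))
        (hmem _ (by positivity) ?_))
    nlinarith [pow_le_pow_left₀ (by linarith) (show 1 + ε ≤ 2 by linarith) 2]

/-- The logarithmic term of the minimax rate, for any class containing the diagonal matrices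
with bounded entries. -/
lemma le_minimaxProb_log {γ c : ℝ} (hn : 1 ≤ n) (hp : 1 ≤ p) (hM : 0 < M)
    (hε0 : 0 ≤ ε) (hε1 : ε ≤ 1)
    (hΘ : ∀ S ∈ boundedClass p M, (∀ i j, i ≠ j → S i j = 0) → S ∈ Θ)
    (hpn : (p : ℝ) ≤ Real.exp (γ * n)) (hc0 : 0 ≤ c) (hc1 : c ≤ 1) (hcγ : c * γ ≤ 1 / 2) :
    ENNReal.ofReal (1 / 8) ≤ minimaxProb n Θ ε ((M / 4) ^ 2 * c * (Real.log p / n)) := by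
  have hn' : (0 : ℝ) < n := by exact_mod_cast hn
  have hp' : (1 : ℝ) ≤ p := by exact_mod_cast hp
  have hlog0 : 0 ≤ Real.log p := Real.log_nonneg hp'
  have hlog : Real.log p ≤ γ * n := by
    rw [← Real.log_exp (γ * n)]
    exact Real.log_le_log (by linarith) hpn
  -- Then `n δ² = c log p`, so `exp(n δ²) ≤ p`, while `c γ ≤ 1/2` keeps `δ² ≤ 1/2`.
  set δ := √(c * (Real.log p / n)) with hδ
  have hδ2 : δ ^ 2 = c * (Real.log p / n) := Real.sq_sqrt (by positivity)
  have hδh : δ ^ 2 ≤ 1 / 2 := by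
    rw [hδ2]
    have : Real.log p / n ≤ γ := (div_le_iff₀ hn').2 hlog
    nlinarith
  have hδ0 : 0 ≤ δ := Real.sqrt_nonneg _
  have hδ1 : δ ≤ 1 := by nlinarith
  have hexp : Real.exp (n * δ ^ 2) ≤ p := by
    rw [hδ2, show n * (c * (Real.log p / n)) = c * Real.log p by field_simp,
      ← Real.le_log_iff_exp_le (by linarith)]
    nlinarith
  have : Nonempty (Fin p) := ⟨⟨0, hp⟩⟩
  have h := le_minimaxProb_of_spikes (n := n) (Θ := Θ) (a := M / 2) hε0 hε1 (by positivity) hδ0 hδh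
    (u := fun j : Fin p => EuclideanSpace.single j (1 : ℝ)) (fun j => by simp)
    (sum_exp_basis_le hexp)
    (hΘ _ (smul_one_mem_boundedClass hM.le) fun i j hij => by simp [hij])
    (fun l => hΘ _ (spike_mem_boundedClass hM.le hδ0 hδ1 (by simp)) fun i j hij => by
      rw [Matrix.smul_apply, Matrix.add_apply, Matrix.smul_apply, vecMulVec_single_offDiag l hij,
        Matrix.one_apply_ne hij]
      simp)
  convert h using 2
  linear_combination -(M / 4) ^ 2 * hδ2

lemma sum_fin_ite_lt {m : ℕ} (hm : m ≤ p) (y : ℝ) :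
    ∑ i : Fin p, (if (i : ℕ) < m then y else 0) = m * y := by
  rw [← Finset.sum_filter, Finset.sum_const, Fin.card_filter_val_lt, nsmul_eq_mul, min_eq_right hm]

/-- The dimension term of the minimax rate, for any class containing the rank one spikes
supported on the first `m` coordinates with flat entries. -/
lemma le_minimaxProb_block {m : ℕ} {c : ℝ} (hn : 1 ≤ n) (hm0 : 1 ≤ m) (hm : m ≤ p) (hM : 0 < M)
    (hε0 : 0 ≤ ε) (hε1 : ε ≤ 1) (hc0 : 0 ≤ c) (hc : c ≤ 1 / 4) (hcm : c * (m / n) ≤ 1 / 2)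
    (h0 : (M / 2) • (1 : Matrix (Fin p) (Fin p) ℝ) ∈ Θ)
    (h1 : ∀ u : EuclideanSpace ℝ (Fin p), ‖u‖ = 1 →
      (∀ i j, |u i * u j| = if (i : ℕ) < m ∧ (j : ℕ) < m then (m : ℝ)⁻¹ else 0) →
      (M / 2) • (1 + √(c * (m / n)) • Matrix.vecMulVec u u) ∈ Θ) :
    ENNReal.ofReal (1 / 8) ≤ minimaxProb n Θ ε ((M / 4) ^ 2 * c * (m / n)) := by
  have hn' : (0 : ℝ) < n := by exact_mod_cast hn
  have hm' : (0 : ℝ) < m := by exact_mod_cast hm0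
  set δ := √(c * (m / n)) with hδ
  have hδ2 : δ ^ 2 = c * (m / n) := Real.sq_sqrt (by positivity)
  -- Flat weights have `∑ w⁴ = 1 / m`, so `n δ² ∑ w⁴ = c`, which is where `c ≤ 1/4` enters.
  set w : Fin p → ℝ := fun i => if (i : ℕ) < m then (√m)⁻¹ else 0 with hw
  have hw2 : ∀ i, w i ^ 2 = if (i : ℕ) < m then (m : ℝ)⁻¹ else 0 := by
    intro i
    simp only [hw]
    split_ifs
    · rw [inv_pow, Real.sq_sqrt hm'.le]
    · simp
  have hw4 : ∀ i, w i ^ 4 = if (i : ℕ) < m then (m : ℝ)⁻¹ ^ 2 else 0 := by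
    intro i
    rw [show w i ^ 4 = (w i ^ 2) ^ 2 by ring, hw2]
    split_ifs <;> simp
  -- Signs are attached to all `p` coordinates; those beyond `m` only repeat each vector equally
  -- often, so the prior stays uniform.
  set u : (Fin p → Bool) → EuclideanSpace ℝ (Fin p) :=
    fun s => WithLp.toLp 2 fun i => signOf (s i) * w i with hu
  have hnorm : ∀ s, ‖u s‖ = 1 := by
    intro s
    rw [← sq_eq_sq₀ (norm_nonneg _) zero_le_one, EuclideanSpace.real_norm_sq_eq, one_pow]
    simp only [hu, mul_pow, signOf_sq, one_mul, hw2]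
    rw [sum_fin_ite_lt hm, mul_inv_cancel₀ hm'.ne']
  have hinner : ∀ s s', ⟪u s, u s'⟫ = ∑ i, signOf (s i) * signOf (s' i) * w i ^ 2 := by
    intro s s'
    simp only [hu, PiLp.inner_apply]
    refine Finset.sum_congr rfl fun i _ => ?_
    simp
    ring
  have habs : ∀ s i j, |u s i * u s j| =
      if (i : ℕ) < m ∧ (j : ℕ) < m then (m : ℝ)⁻¹ else 0 := by
    intro s i j
    have hwn : ∀ i, |w i| = w i := fun i => abs_of_nonneg (by simp only [hw]; split_ifs <;> positivity)
    simp only [hu, abs_mul, abs_signOf, one_mul, hwn]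
    by_cases hi : (i : ℕ) < m <;> by_cases hj : (j : ℕ) < m <;> simp [hw, hi, hj]
    rw [← mul_inv, Real.mul_self_sqrt hm'.le]
  have hsecond : ∑ s, ∑ s', Real.exp (n * δ ^ 2 * ⟪u s, u s'⟫ ^ 2) ≤
      2 * (Fintype.card (Fin p → Bool) : ℝ) ^ 2 := by
    simp_rw [hinner]
    refine sum_exp_sq_sign_le w (by positivity) ?_
    simp_rw [hw4]
    rw [sum_fin_ite_lt hm, hδ2]
    refine le_trans (le_of_eq ?_) hc
    field_simp
  have h := le_minimaxProb_of_spikes (n := n) (Θ := Θ) (a := M / 2) hε0 hε1 (by positivity)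
    (Real.sqrt_nonneg _) (hδ2.trans_le hcm) hnorm hsecond h0 fun s => h1 _ (hnorm s) (habs s)
  convert h using 2
  linear_combination -(M / 4) ^ 2 * hδ2

lemma diagonal_mem_bandedClass (k : ℕ) {S : Matrix (Fin p) (Fin p) ℝ} (hS : S ∈ boundedClass p M)
    (hd : ∀ i j, i ≠ j → S i j = 0) : S ∈ bandedClass p k M := by
  refine ⟨hS, fun i j hij => hd i j ?_⟩
  rintro rfl
  simp at hij
  omega

lemma diagonal_mem_bandableClass {α M₀ : ℝ} (hM₀ : 0 ≤ M₀) {S : Matrix (Fin p) (Fin p) ℝ}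
    (hS : S ∈ boundedClass p M) (hd : ∀ i j, i ≠ j → S i j = 0) : S ∈ bandableClass p α M M₀ := by
  refine ⟨hS, fun k _ j => ?_⟩
  rw [Finset.sum_eq_zero fun i hi => ?_]
  · positivity
  · rw [hd i j, abs_zero]
    rintro rfl
    simp at hi
    omega

lemma spike_apply_offDiag (a δ : ℝ) (u : EuclideanSpace ℝ (Fin p)) {i j : Fin p} (hij : i ≠ j) :
    (a • (1 + δ • Matrix.vecMulVec u u)) i j = a * δ * (u i * u j) := by
  rw [Matrix.smul_apply, Matrix.add_apply, Matrix.smul_apply, Matrix.one_apply_ne hij,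
    Matrix.vecMulVec_apply, zero_add, smul_eq_mul, smul_eq_mul, mul_assoc]

lemma block_mem_bandedClass {k : ℕ} {δ : ℝ} (hM : 0 ≤ M) (hδ0 : 0 ≤ δ) (hδ1 : δ ≤ 1)
    {u : EuclideanSpace ℝ (Fin p)} (hu : ‖u‖ = 1)
    (habs : ∀ i j, |u i * u j| = if (i : ℕ) < k ∧ (j : ℕ) < k then (k : ℝ)⁻¹ else 0) :
    (M / 2) • (1 + δ • Matrix.vecMulVec u u) ∈ bandedClass p k M := by
  refine ⟨spike_mem_boundedClass hM hδ0 hδ1 hu, fun i j hij => ?_⟩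
  have hne : i ≠ j := by
    rintro rfl
    simp at hij
    omega
  have hz : u i * u j = 0 := by
    rw [← abs_eq_zero, habs, if_neg]
    rintro ⟨hi, hj⟩
    rw [lt_abs] at hij
    omega
  rw [spike_apply_offDiag _ _ _ hne, hz, mul_zero]

/-- For `k ≥ m` no block entry is that far from the diagonal. For `k < m` a column has at most `m`
block entries of size `M δ / (2 m)`, so the sum is at most `M δ / 2 ≤ M₀ m ^ (-α) ≤ M₀ k ^ (-α)`. -/
lemma block_mem_bandableClass {m : ℕ} {δ α M₀ : ℝ} (hm0 : 1 ≤ m) (hm : m ≤ p) (hM : 0 ≤ M)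
    (hM₀ : 0 ≤ M₀) (hα : 0 ≤ α) (hδ0 : 0 ≤ δ) (hδ1 : δ ≤ 1)
    (hδm : M / 2 * δ ≤ M₀ * (m : ℝ) ^ (-α)) {u : EuclideanSpace ℝ (Fin p)} (hu : ‖u‖ = 1)
    (habs : ∀ i j, |u i * u j| = if (i : ℕ) < m ∧ (j : ℕ) < m then (m : ℝ)⁻¹ else 0) :
    (M / 2) • (1 + δ • Matrix.vecMulVec u u) ∈ bandableClass p α M M₀ := by
  have hm' : (0 : ℝ) < m := by exact_mod_cast hm0
  refine ⟨spike_mem_boundedClass hM hδ0 hδ1 hu, fun k hk j => ?_⟩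
  have hk' : (0 : ℝ) < k := by exact_mod_cast hk
  have hterm : ∀ i : Fin p, (k : ℤ) < |((i : ℕ) : ℤ) - ((j : ℕ) : ℤ)| →
      |((M / 2) • (1 + δ • Matrix.vecMulVec u u)) i j| =
        M / 2 * δ * if (i : ℕ) < m ∧ (j : ℕ) < m then (m : ℝ)⁻¹ else 0 := by
    intro i hi
    have hne : i ≠ j := by
      rintro rfl
      simp at hi
      omega
    rw [spike_apply_offDiag _ _ _ hne, abs_mul, habs, abs_of_nonneg (by positivity)]
  rcases le_or_gt m k with hmk | hmk
  · rw [Finset.sum_eq_zero fun i hi => ?_]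
    · positivity
    · have hi' := (Finset.mem_filter.1 hi).2
      rw [hterm i hi', if_neg, mul_zero]
      rintro ⟨h1, h2⟩
      rw [lt_abs] at hi'
      omega
  · calc _ ≤ ∑ i ∈ Finset.univ.filter (fun i : Fin p =>
          (k : ℤ) < |((i : ℕ) : ℤ) - ((j : ℕ) : ℤ)|),
          M / 2 * δ * (if (i : ℕ) < m then (m : ℝ)⁻¹ else 0) := by
          refine Finset.sum_le_sum fun i hi => ?_
          rw [hterm i (Finset.mem_filter.1 hi).2]
          refine mul_le_mul_of_nonneg_left ?_ (by positivity)
          by_cases h1 : (i : ℕ) < m <;> by_cases h2 : (j : ℕ) < m <;> simp [h1, h2]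
      _ ≤ ∑ i : Fin p, M / 2 * δ * (if (i : ℕ) < m then (m : ℝ)⁻¹ else 0) :=
          Finset.sum_le_sum_of_subset_of_nonneg (Finset.filter_subset _ _) fun i _ _ => by
            split_ifs <;> positivity
      _ = M / 2 * δ := by
          rw [← Finset.mul_sum, sum_fin_ite_lt hm, mul_inv_cancel₀ hm'.ne', mul_one]
      _ ≤ M₀ * (m : ℝ) ^ (-α) := hδm
      _ ≤ M₀ * (k : ℝ) ^ (-α) := by
          refine mul_le_mul_of_nonneg_left ?_ hM₀
          exact Real.rpow_le_rpow_of_nonpos hk' (by exact_mod_cast hmk.le) (by linarith)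

end Classes

/-! ### Choice of constants and block size -/

section Rates

theorem bandedClass_lower_bound {M γ κ : ℝ} (hM : 0 < M) (hγ : 0 < γ) (hκ : 0 < κ) :
    ∃ C c : ℝ, 0 < C ∧ 0 < c ∧
      ∀ n p k : ℕ, 1 ≤ n → 1 ≤ p → (p : ℝ) ≤ Real.exp (γ * n) → k ≤ p → (k : ℝ) ≤ κ * n →
        ∀ ε : ℝ, 0 ≤ ε → ε ≤ 1 →
          ENNReal.ofReal c ≤ minimaxProb n (bandedClass p k M) ε
            (C * max (((k : ℝ) + Real.log p) / n) (ε ^ 2)) := by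
  -- The entries serve the sign prior, `c k / n ≤ 1/2`, and the logarithmic term, respectively.
  set c : ℝ := min (1 / 4) (min (1 / (2 * κ)) (1 / (2 * γ))) with hc
  have hc0 : 0 < c := by positivity
  have hc4 : c ≤ 1 / 4 := min_le_left _ _
  have hcκ : c * κ ≤ 1 / 2 := by
    have : c ≤ 1 / (2 * κ) := (min_le_right _ _).trans (min_le_left _ _)
    rw [le_div_iff₀ (by positivity)] at this
    linarith
  have hcγ : c * γ ≤ 1 / 2 := by
    have : c ≤ 1 / (2 * γ) := (min_le_right _ _).trans (min_le_right _ _)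
    rw [le_div_iff₀ (by positivity)] at this
    linarith
  -- The factor `1/2` absorbs `k + log p ≤ 2 max(k, log p)`.
  refine ⟨(M / 4) ^ 2 * c / 2, 1 / 8, by positivity, by norm_num, ?_⟩
  intro n p k hn hp hpn hkp hkn ε hε0 hε1
  have hn' : (0 : ℝ) < n := by exact_mod_cast hn
  have hlog0 : 0 ≤ Real.log p := Real.log_nonneg (by exact_mod_cast hp)
  have hdiag : ∀ S ∈ boundedClass p M, (∀ i j, i ≠ j → S i j = 0) → S ∈ bandedClass p k M :=
    fun S hS hd => diagonal_mem_bandedClass k hS hd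
  have hA : 0 < (M / 4) ^ 2 := by positivity
  rcases le_total (((k : ℝ) + Real.log p) / n) (ε ^ 2) with h | h
  · refine (le_minimaxProb_eps hp hM hε0 hε1 hdiag).trans (minimaxProb_antitone _ _ ?_)
    rw [max_eq_right h, mul_div_assoc, mul_assoc]
    exact mul_le_mul_of_nonneg_left (by nlinarith [sq_nonneg ε]) hA.le
  rw [max_eq_left h]
  rcases le_or_gt (k : ℝ) (Real.log p) with h' | h'
  · refine (le_minimaxProb_log hn hp hM hε0 hε1 hdiag hpn hc0.le (by linarith) hcγ).trans
      (minimaxProb_antitone _ _ ?_)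
    rw [mul_div_assoc, mul_assoc, mul_assoc]
    refine mul_le_mul_of_nonneg_left ?_ hA.le
    rw [div_mul_eq_mul_div, mul_div_assoc]
    refine mul_le_mul_of_nonneg_left ?_ hc0.le
    rw [div_div, div_le_div_iff₀ (by positivity) hn']
    nlinarith
  · have hk0 : 1 ≤ k := by
      rw [Nat.one_le_iff_ne_zero]
      rintro rfl
      norm_num at h'
      linarith
    have hcm : c * (k / n) ≤ 1 / 2 := by
      have : (k : ℝ) / n ≤ κ := (div_le_iff₀ hn').2 hkn
      nlinarith
    refine (le_minimaxProb_block hn hk0 hkp hM hε0 hε1 hc0.le hc4 hcm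
      (hdiag _ (smul_one_mem_boundedClass hM.le) fun i j hij => by simp [hij])
      fun u hu habs => block_mem_bandedClass hM.le (Real.sqrt_nonneg _)
        (Real.sqrt_le_one.2 (by linarith)) hu habs).trans (minimaxProb_antitone _ _ ?_)
    rw [mul_div_assoc, mul_assoc, mul_assoc]
    refine mul_le_mul_of_nonneg_left ?_ hA.le
    rw [div_mul_eq_mul_div, mul_div_assoc]
    refine mul_le_mul_of_nonneg_left ?_ hc0.le
    rw [div_div, div_le_div_iff₀ (by positivity) hn']
    nlinarith

theorem bandableClass_lower_bound {α M M₀ γ : ℝ} (hα : 0 < α) (hM : 0 < M) (hM₀ : 0 < M₀)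
    (hγ : 0 < γ) :
    ∃ C c : ℝ, 0 < C ∧ 0 < c ∧
      ∀ n p : ℕ, 1 ≤ n → 1 ≤ p → (p : ℝ) ≤ Real.exp (γ * n) →
        ∀ ε : ℝ, 0 ≤ ε → ε ≤ 1 →
          ENNReal.ofReal c ≤ minimaxProb n (bandableClass p α M M₀) ε
            (C * max (min ((n : ℝ) ^ (-(2 * α) / (2 * α + 1)) + Real.log p / n)
              ((p : ℝ) / n)) (ε ^ 2)) := by
  -- The entry `(2 M₀ / M)²` makes the spike obey the decay condition.
  set c : ℝ := min (1 / 4) (min (1 / (2 * γ)) ((2 * M₀ / M) ^ 2)) with hc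
  have hc0 : 0 < c := by positivity
  have hc4 : c ≤ 1 / 4 := min_le_left _ _
  have hcγ : c * γ ≤ 1 / 2 := by
    have : c ≤ 1 / (2 * γ) := (min_le_right _ _).trans (min_le_left _ _)
    rw [le_div_iff₀ (by positivity)] at this
    linarith
  have hcM : c ≤ (2 * M₀ / M) ^ 2 := (min_le_right _ _).trans (min_le_right _ _)
  -- One factor 2 is lost in `x + L ≤ 2 max(x, L)`, another in rounding `t` down.
  refine ⟨(M / 4) ^ 2 * c / 4, 1 / 8, by positivity, by norm_num, ?_⟩
  intro n p hn hp hpn ε hε0 hε1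
  have hn1 : (1 : ℝ) ≤ n := by exact_mod_cast hn
  have hn' : (0 : ℝ) < n := by linarith
  have hlog0 : 0 ≤ Real.log p := Real.log_nonneg (by exact_mod_cast hp)
  have hdiag : ∀ S ∈ boundedClass p M, (∀ i j, i ≠ j → S i j = 0) → S ∈ bandableClass p α M M₀ :=
    fun S hS hd => diagonal_mem_bandableClass hM₀.le hS hd
  have hA : 0 < (M / 4) ^ 2 := by positivity
  set x : ℝ := (n : ℝ) ^ (-(2 * α) / (2 * α + 1)) with hx
  set L : ℝ := Real.log p / n with hL
  have hL0 : 0 ≤ L := by positivity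
  rcases le_total (min (x + L) ((p : ℝ) / n)) (ε ^ 2) with h | h
  · refine (le_minimaxProb_eps hp hM hε0 hε1 hdiag).trans (minimaxProb_antitone _ _ ?_)
    rw [max_eq_right h, mul_div_assoc, mul_assoc]
    exact mul_le_mul_of_nonneg_left (by nlinarith [sq_nonneg ε]) hA.le
  rw [max_eq_left h]
  rcases le_total x L with h' | h'
  · refine (le_minimaxProb_log hn hp hM hε0 hε1 hdiag hpn hc0.le (by linarith) hcγ).trans
      (minimaxProb_antitone _ _ ?_)
    have : min (x + L) ((p : ℝ) / n) ≤ 4 * L := (min_le_left _ _).trans (by linarith)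
    rw [mul_div_assoc, mul_assoc, mul_assoc]
    refine mul_le_mul_of_nonneg_left ?_ hA.le
    nlinarith
  -- `t` solves `t / n = t ^ (-2 α)`, so it is the largest block size at which a spike with `δ² ≍ m
  -- / n` still decays fast enough.
  set t : ℝ := (n : ℝ) ^ (1 / (2 * α + 1)) with ht
  have ht1 : 1 ≤ t := Real.one_le_rpow hn1 (by positivity)
  have htn : t / n = x := by
    rw [ht, hx, ← Real.rpow_sub_one hn'.ne']
    congr 1
    field_simp
    ring
  have htpow : t ^ (2 * α + 1) = n := by
    rw [ht, ← Real.rpow_mul hn'.le, one_div_mul_cancel (by positivity), Real.rpow_one]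
  set m : ℕ := min p ⌊t⌋₊ with hm
  have hm0 : 1 ≤ m := le_min hp ((Nat.one_le_floor_iff _).2 ht1)
  have hm1 : (1 : ℝ) ≤ m := by exact_mod_cast hm0
  have hmt : (m : ℝ) ≤ t :=
    le_trans (by exact_mod_cast min_le_right p ⌊t⌋₊) (Nat.floor_le (by linarith))
  have hpow : (m : ℝ) / n ≤ ((m : ℝ) ^ (-α)) ^ 2 := by
    have h1 : (m : ℝ) ^ (2 * α + 1) ≤ n := by
      rw [← htpow]
      exact Real.rpow_le_rpow (by linarith) hmt (by positivity)
    rw [← Real.rpow_natCast, ← Real.rpow_mul (by linarith), div_le_iff₀ hn']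
    calc (m : ℝ) = (m : ℝ) ^ (-α * (2 : ℕ)) * (m : ℝ) ^ (2 * α + 1) := by
          rw [← Real.rpow_add (by linarith)]
          conv_lhs => rw [← Real.rpow_one (m : ℝ)]
          congr 1
          push_cast
          ring
      _ ≤ _ := mul_le_mul_of_nonneg_left h1 (by positivity)
  have hmn : (m : ℝ) / n ≤ 1 := by
    refine hpow.trans (pow_le_one₀ (by positivity) ?_)
    exact Real.rpow_le_one_of_one_le_of_nonpos hm1 (by linarith)
  have hcm : c * (m / n) ≤ 1 / 2 := by nlinarith [show (0 : ℝ) ≤ m / n by positivity]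
  have hδm : M / 2 * √(c * (m / n)) ≤ M₀ * (m : ℝ) ^ (-α) := by
    refine le_of_sq_le_sq ?_ (by positivity)
    rw [mul_pow, Real.sq_sqrt (by positivity), mul_pow]
    calc (M / 2) ^ 2 * (c * (m / n)) ≤ (M / 2) ^ 2 * ((2 * M₀ / M) ^ 2 * ((m : ℝ) ^ (-α)) ^ 2) := by
          gcongr
      _ = _ := by
          field_simp
  refine (le_minimaxProb_block hn hm0 (min_le_left _ _) hM hε0 hε1 hc0.le hc4 hcm
    (hdiag _ (smul_one_mem_boundedClass hM.le) fun i j hij => by simp [hij])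
    fun u hu habs => block_mem_bandableClass hm0 (min_le_left _ _) hM.le hM₀.le hα.le
      (Real.sqrt_nonneg _) (Real.sqrt_le_one.2 (by linarith)) hδm hu habs).trans
    (minimaxProb_antitone _ _ ?_)
  -- If `p` caps `m`, the bound `p / n` is used; otherwise `t ≥ 1` gives `t ≤ 2 ⌊t⌋`.
  have hrate : min (x + L) ((p : ℝ) / n) ≤ 4 * (m / n) := by
    rcases le_total p ⌊t⌋₊ with hpt | hpt
    · rw [hm, min_eq_left hpt]
      exact (min_le_right _ _).trans (by linarith [show (0 : ℝ) ≤ p / n by positivity])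
    · have h2 : t ≤ 2 * m := by
        rw [hm, min_eq_right hpt]
        have h3 := Nat.lt_floor_add_one t
        have h4 : (1 : ℝ) ≤ ⌊t⌋₊ := by exact_mod_cast (Nat.one_le_floor_iff _).2 ht1
        linarith
      have h5 : x ≤ 2 * (m / n) := by
        rw [← htn, ← mul_div_assoc]
        exact div_le_div_of_nonneg_right h2 hn'.le
      exact (min_le_left _ _).trans (by linarith)
  rw [mul_div_assoc, mul_assoc, mul_assoc]
  refine mul_le_mul_of_nonneg_left ?_ hA.le
  nlinarith

end Rates

end RobustCov

theorem theorem3p5 :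
    (∀ M γ κ : ℝ, 0 < M → 0 < γ → 0 < κ →
      ∃ C c : ℝ, 0 < C ∧ 0 < c ∧
        ∀ n p k : ℕ, 1 ≤ n → 1 ≤ p → (p : ℝ) ≤ Real.exp (γ * n) →
          k ≤ p → (k : ℝ) ≤ κ * n →
          ∀ ε : ℝ, 0 ≤ ε → ε ≤ 1 →
            ENNReal.ofReal c ≤
              RobustCov.minimaxProb n (RobustCov.bandedClass p k M) ε
                (C * max (((k : ℝ) + Real.log p) / n) (ε ^ 2))) ∧
    (∀ α M M₀ γ : ℝ, 0 < α → 0 < M → 0 < M₀ → 0 < γ →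
      ∃ C c : ℝ, 0 < C ∧ 0 < c ∧
        ∀ n p : ℕ, 1 ≤ n → 1 ≤ p → (p : ℝ) ≤ Real.exp (γ * n) →
          ∀ ε : ℝ, 0 ≤ ε → ε ≤ 1 →
            ENNReal.ofReal c ≤
              RobustCov.minimaxProb n (RobustCov.bandableClass p α M M₀) ε
                (C * max (min ((n : ℝ) ^ (-(2 * α) / (2 * α + 1)) + Real.log p / n)
                  ((p : ℝ) / n)) (ε ^ 2))) :=
  ⟨fun _ _ _ hM hγ hκ => RobustCov.bandedClass_lower_bound hM hγ hκ,
    fun _ _ _ _ hα hM hM₀ hγ => RobustCov.bandableClass_lower_bound hα hM hM₀ hγ⟩
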